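/- **Theorem 1.2 (Subadditivity of Matrix $\varphi$-Entropy).** *Notation.* For $d\in\mathbb N$, $\mathbb M^d$ is the space of complex $d\times d$ matrices with the $\ell_2$ operator norm $\|\cdot\|$, $\mathbb H^d$ its real subspace of Hermitian matrices, and $\mathbb H^d_+$, $\mathbb H^d_{++}$ the sets of positive-semidefinite and positive-definite matrices. Write $\bar{\mathrm{tr}}\,B=\frac1d\sum_j b_{jj}$ and $\langle A,B\rangle=\bar{\mathrm{tr}}(A^*B)$. A scalar function $f$ acts on a Hermitian matrix through its eigenvalues: $f(A)=\sum_i f(\lambda_i)P_i$ if $A=\sum_i\lambda_iP_i$ is the spectral resolution. *The class $\Phi_\infty$.* For $d\ge 1$, the class $\Phi_d$ consists of the functions $\varphi:[0,\infty)\to\mathbb R$ that are either affine or satisfy all of the following: (1) $\varphi$ is continuous and convex; (2) $\varphi$ has two continuous derivatives on $(0,\infty)$; (3) with $\psi=\varphi'$ on $(0,\infty)$, the matrix function $\psi:\mathbb H^d_{++}\to\mathbb H^d$ is Fréchet differentiable at each $A\in\mathbb H^d_{++}$, its derivative $\mathsf D\psi(A)$ is an invertible linear operator, and $A\mapsto[\mathsf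 D\psi(A)]^{-1}$ is concave on $\mathbb H^d_{++}$ with respect to the semidefinite order on operators (where $\mathsf S\preccurlyeq\mathsf T$ means that $\mathsf T-\mathsf S$ is self-adjoint and $\langle H,(\mathsf T-\mathsf S)(H)\rangle\ge0$ for all $H$). Put $\Phi_\infty=\bigcap_{d\ge1}\Phi_d$. *Entropy.* For a random matrix $Z$ with values in $\mathbb H^d_+$ such that $\mathbb E\|Z\|<\infty$ and $\mathbb E\|\varphi(Z)\|<\infty$, and a sub-$\sigma$-algebra $\mathcal F$, let $$H_\varphi(Z)=\mathbb E\,\bar{\mathrm{tr}}\,\varphi(Z)-\bar{\mathrm{tr}}\,\varphi(\mathbb E Z),\qquad H_\varphi(Z\,|\,\mathcal F)=\mathbb E[\bar{\mathrm{tr}}\,\varphi(Z)\,|\,\mathcal F]-\bar{\mathrm{tr}}\,\varphi(\mathbb E[Z\,|\,\mathcal F]).$$ *Statement.* Let $\varphi\in\Phi_\infty$. Let $X_1,\dots,X_n$ be independent random variables taking values in Polish spaces, and let $x_{-i}$ be the random vector $(X_1,\dots,X_n)$ with its $i$th entry deleted. Let $Z=Z(X_1,\dots,X_n)$ be a measurable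 function of $(X_1,\dots,X_n)$ that takes values in $\mathbb H^d_+$, and suppose that $\mathbb E\|Z\|<\infty$ and $\mathbb E\|\varphi(Z)\|<\infty$. Then each $H_\varphi(Z\,|\,x_{-i})$ is integrable, and $$H_\varphi(Z)\ \le\ \sum_{i=1}^n\mathbb E\big[H_\varphi(Z\,|\,x_{-i})\big].$$ -/

import Mathlib

open MeasureTheory ProbabilityTheory
open scoped Matrix.Norms.L2Operator ComplexOrder

noncomputable section

namespace MatrixEntropy

/-- `𝕄 d`: complex `d × d` matrices. Throughout, the norm is the `ℓ₂` operator norm. -/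
abbrev CMat (d : ℕ) : Type := Matrix (Fin d) (Fin d) ℂ

/-- The real Banach space of Hermitian `d × d` matrices: a real subspace of `𝕄 d`, with the inherited
addition, scalar multiplication and norm. -/
def Herm (d : ℕ) : Type := selfAdjoint.submodule ℝ (CMat d)

instance (d : ℕ) : NormedAddCommGroup (Herm d) :=
  inferInstanceAs (NormedAddCommGroup (selfAdjoint.submodule ℝ (CMat d)))

instance (d : ℕ) : NormedSpace ℝ (Herm d) :=
  inferInstanceAs (NormedSpace ℝ (selfAdjoint.submodule ℝ (CMat d)))

instance (d : ℕ) : CoeOut (Herm d) (CMat d) := ⟨Subtype.val⟩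

/-- Normalized trace `d⁻¹ ∑ⱼ bⱼⱼ`. -/
def ntr {d : ℕ} (B : CMat d) : ℂ := (1 / (d : ℂ)) * ∑ j, B j j

/-- Normalized trace inner product `⟨A, B⟩ = ntr (A* B)`. -/
def trInner {d : ℕ} (A B : CMat d) : ℂ := ntr (A.conjTranspose * B)

/-- The standard matrix function `A ↦ f(A)`, applying `f` to the eigenvalues, on Hermitian matrices.
Only the values of `f` on the spectrum of `A` matter. -/
def stdFun (d : ℕ) (f : ℝ → ℝ) (A : Herm d) : Herm d :=
  ⟨cfc f (A : CMat d), cfc_predicate f (A : CMat d)⟩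

/-- A real-linear operator `T` on Hermitian matrices is positive semidefinite: self-adjoint, with
`⟨A, T A⟩ ≥ 0`. Complex-linear extension gives all Hermitian-preserving operators on `𝕄 d`, and, for
`A, B` Hermitian and `T` self-adjoint, `⟨A + iB, T (A + iB)⟩ = ⟨A, T A⟩ + ⟨B, T B⟩`, so `T` is
positive semidefinite in this sense exactly when its extension to `𝕄 d` is. -/
def OpPosSemidef {d : ℕ} (T : Herm d →L[ℝ] Herm d) : Prop :=
  (∀ A B : Herm d, trInner (A : CMat d) (T B : CMat d) = trInner (T A : CMat d) (B : CMat d)) ∧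
    ∀ A : Herm d, 0 ≤ (trInner (A : CMat d) (T A : CMat d)).re

/-- The semidefinite order on operators. -/
def OpLE {d : ℕ} (S T : Herm d →L[ℝ] Herm d) : Prop := OpPosSemidef (T - S)

/-- The class `Φ_d`. A function `φ : ℝ₊ → ℝ` is represented by a function on `ℝ` of which only the
values on `[0, ∞)` matter; `deriv φ` is only evaluated on `(0, ∞)`. -/
def PhiClass (d : ℕ) : Set (ℝ → ℝ) :=
  {φ | (∃ a b : ℝ, ∀ t, 0 ≤ t → φ t = a * t + b) ∨
    (ContinuousOn φ (Set.Ici 0) ∧ ConvexOn ℝ (Set.Ici 0) φ ∧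
      ContDiffOn ℝ 2 φ (Set.Ioi 0) ∧
      (∀ A : Herm d, (A : CMat d).PosDef →
        DifferentiableAt ℝ (stdFun d (deriv φ)) A ∧
          (fderiv ℝ (stdFun d (deriv φ)) A).IsInvertible) ∧
      (∀ A B : Herm d, (A : CMat d).PosDef → (B : CMat d).PosDef →
        ∀ α : ℝ, 0 ≤ α → α ≤ 1 →
          OpLE
            (α • (fderiv ℝ (stdFun d (deriv φ)) A).inverse +
              (1 - α) • (fderiv ℝ (stdFun d (deriv φ)) B).inverse)
            (fderiv ℝ (stdFun d (deriv φ)) (α • A + (1 - α) • B)).inverse))}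

/-- The class `Φ_∞` of matrix entropies: the intersection of `Φ_d` over `d ≥ 1`. -/
def PhiInf : Set (ℝ → ℝ) := {φ | ∀ d : ℕ, 1 ≤ d → φ ∈ PhiClass d}

/-- Matrix `φ`-entropy `H_φ(Z) = 𝔼 ntr φ(Z) - ntr φ(𝔼 Z)`. The normalized traces are real, since
`φ(Z)` and `φ(𝔼 Z)` are Hermitian. -/
def entropy {Ω : Type*} [MeasurableSpace Ω] {d : ℕ} (φ : ℝ → ℝ) (Z : Ω → CMat d)
    (μ : Measure Ω) : ℝ :=
  (∫ ω, (ntr (cfc φ (Z ω))).re ∂μ) - (ntr (cfc φ (∫ ω, Z ω ∂μ))).re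

/-- Conditional matrix `φ`-entropy `H_φ(Z | 𝓕) = 𝔼[ntr φ(Z) | 𝓕] - ntr φ(𝔼[Z | 𝓕])`. -/
def condEntropy {Ω : Type*} [MeasurableSpace Ω] {d : ℕ} (φ : ℝ → ℝ) (Z : Ω → CMat d)
    (μ : Measure Ω) (𝓕 : MeasurableSpace Ω) (ω : Ω) : ℝ :=
  (μ[fun ω' => (ntr (cfc φ (Z ω'))).re | 𝓕]) ω - (ntr (cfc φ ((μ[Z | 𝓕]) ω))).re

/-- The sigma-algebra generated by the vector `x₋ᵢ` of all the `X j` with `j ≠ i`. -/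
abbrev sigmaOmit {Ω : Type*} {n : ℕ} {E : Fin n → Type*} [∀ i, MeasurableSpace (E i)]
    (X : ∀ i, Ω → E i) (i : Fin n) : MeasurableSpace Ω :=
  MeasurableSpace.comap (fun ω (j : {j : Fin n // j ≠ i}) => X j.1 ω) MeasurableSpace.pi

end MatrixEntropy

end

open MatrixEntropy

noncomputable section

namespace MatrixEntropy

variable {d : ℕ}

/-! Write f for the real normalized trace of φ and D(A, B) = f(A) - f(B) - ⟨φ'(B), A - B⟩ for its
Bregman divergence. Everything reduces to the joint convexity of D. The gradient of f is φ', so the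
second derivative of f is the quadratic form ⟨H, Dψ(A) H⟩ with ψ = φ'. Concavity of A ↦ Dψ(A)⁻¹
makes this form jointly convex in (A, H), because ⟨H, S H⟩ is the supremum over K of 2⟨H, K⟩ - ⟨K,
S⁻¹ K⟩ (`hermPair_fderiv_jointly_convex`). Two integrations along segments carry the convexity over
to D (`bregman_hermIncl_jointly_convex`).

The linear term of D averages out against a conditional expectation, so 𝔼 D(W, 𝔼[W | G]) = 𝔼 f(W) -
𝔼 f(𝔼[W | G]) (`BregmanConvex.integral_bregman_condExp`). If conditioning on G and on K commutes,
conditional Jensen for D shows that this gap does not increase when W is replaced by 𝔼[W | K]. This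
is the four-term inequality `BregmanConvex.four_term`. Since ψ may blow up at 0, it is proved for
matrices above ε times the identity and extended by letting ε tend to 0.

For independent variables, conditional expectations over sets of indices compose by intersection
(`condExp_condExp_sigmaOn`). Reveal the variables one at a time: the entropy is the telescoping sum
of the increments of 𝔼 f(𝔼[Z | X₁, …, X_k]), and the four-term inequality bounds the increment of
the ith variable by 𝔼 H_φ(Z | x₋ᵢ). -/

/-- The real part of the normalized trace, as a continuous real-linear functional. -/
def reTr : CMat d →L[ℝ] ℝ :=
  LinearMap.toContinuousLinearMap
    { toFun := fun A => (ntr A).re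
      map_add' := fun A B => by simp [ntr, Finset.sum_add_distrib, mul_add]
      map_smul' := fun c A => by
        simp only [ntr, Matrix.smul_apply, ← Finset.smul_sum, mul_smul_comm, Complex.smul_re,
          RingHom.id_apply] }

lemma reTr_apply (A : CMat d) : reTr A = (ntr A).re := rfl

lemma reTr_eq_trace (A : CMat d) : reTr A = (d : ℝ)⁻¹ * (Matrix.trace A).re := by
  have : (1 / (d : ℂ)) = (((d : ℝ)⁻¹ : ℝ) : ℂ) := by push_cast; simp
  rw [reTr_apply, ntr, this, Complex.re_ofReal_mul]
  rfl

/-! ### Spectral sums over pairs of eigenbases. -/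

/-- The squared overlaps of the eigenvectors of two Hermitian matrices. -/
def overlap {A B : CMat d} (hA : A.IsHermitian) (hB : B.IsHermitian) (i j : Fin d) : ℝ :=
  Complex.normSq ((star (hA.eigenvectorUnitary : CMat d) * (hB.eigenvectorUnitary : CMat d)) i j)

section Overlap

variable {A B : CMat d} (hA : A.IsHermitian) (hB : B.IsHermitian)

lemma overlap_nonneg (i j : Fin d) : 0 ≤ overlap hA hB i j := Complex.normSq_nonneg _

lemma overlap_symm (i j : Fin d) : overlap hB hA j i = overlap hA hB i j := by
  have : star (hB.eigenvectorUnitary : CMat d) * (hA.eigenvectorUnitary : CMat d) =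
      star (star (hA.eigenvectorUnitary : CMat d) * (hB.eigenvectorUnitary : CMat d)) := by
    simp
  rw [overlap, this, overlap, Matrix.star_apply, Complex.star_def, Complex.normSq_conj]

/-- The change of basis between two eigenbases is unitary, so its rows have unit length. With the
column version, the overlaps form a doubly stochastic matrix, which reduces trace inequalities to
scalar ones. -/
lemma sum_overlap (i : Fin d) : ∑ j, overlap hA hB i j = 1 := by
  set W : CMat d := star (hA.eigenvectorUnitary : CMat d) * (hB.eigenvectorUnitary : CMat d)
    with hW
  have h1 : W * star W = 1 := by
    rw [hW, star_mul, star_star, mul_assoc, ← mul_assoc (hB.eigenvectorUnitary : CMat d),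
      Unitary.mul_star_self_of_mem hB.eigenvectorUnitary.2, one_mul,
      Unitary.star_mul_self_of_mem hA.eigenvectorUnitary.2]
  have h2 : (W * star W) i i = ((∑ j, overlap hA hB i j : ℝ) : ℂ) := by
    rw [Matrix.mul_apply]
    push_cast
    refine Finset.sum_congr rfl fun j _ => ?_
    rw [Matrix.star_apply, Complex.star_def, Complex.mul_conj, overlap]
  rw [h1, Matrix.one_apply_eq] at h2
  exact_mod_cast h2.symm

lemma sum_overlap' (j : Fin d) : ∑ i, overlap hA hB i j = 1 := by
  simp_rw [← overlap_symm hA hB]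
  exact sum_overlap hB hA j

lemma cfc_eq_mul_diagonal_mul (g : ℝ → ℝ) :
    cfc g A = (hA.eigenvectorUnitary : CMat d) *
      Matrix.diagonal (fun i => (g (hA.eigenvalues i) : ℂ)) *
      star (hA.eigenvectorUnitary : CMat d) := by
  rw [hA.cfc_eq, Matrix.IsHermitian.cfc, Unitary.conjStarAlgAut_apply]
  rfl

/-- The diagonal entries of `g(B)` in the eigenbasis of `A`. -/
lemma diag_cfc_eigenbasis (g : ℝ → ℝ) (i : Fin d) :
    (star (hA.eigenvectorUnitary : CMat d) * cfc g B * (hA.eigenvectorUnitary : CMat d)) i i =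
      ((∑ j, overlap hA hB i j * g (hB.eigenvalues j) : ℝ) : ℂ) := by
  set U : CMat d := (hA.eigenvectorUnitary : CMat d) with hU
  set V : CMat d := (hB.eigenvectorUnitary : CMat d) with hV
  have h1 : star U * cfc g B * U =
      (star U * V) * Matrix.diagonal (fun i => (g (hB.eigenvalues i) : ℂ)) * star (star U * V) := by
    rw [cfc_eq_mul_diagonal_mul hB, star_mul, star_star]
    simp only [mul_assoc]
    rfl
  rw [h1, Matrix.mul_apply]
  push_cast
  refine Finset.sum_congr rfl fun j _ => ?_
  rw [Matrix.mul_diagonal, Matrix.star_apply, Complex.star_def, mul_right_comm, Complex.mul_conj,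
    overlap]

lemma reTr_cfc_mul (h : ℝ → ℝ) (M : CMat d) :
    reTr (cfc h A * M) = (d : ℝ)⁻¹ * ∑ i, h (hA.eigenvalues i) *
      ((star (hA.eigenvectorUnitary : CMat d) * M * (hA.eigenvectorUnitary : CMat d)) i i).re := by
  set U : CMat d := (hA.eigenvectorUnitary : CMat d) with hU
  have h1 : Matrix.trace (cfc h A * M) =
      Matrix.trace (Matrix.diagonal (fun i => (h (hA.eigenvalues i) : ℂ)) * (star U * M * U)) := by
    rw [cfc_eq_mul_diagonal_mul hA, ← hU]
    simp only [mul_assoc]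
    rw [Matrix.trace_mul_comm]
    simp only [mul_assoc]
  rw [reTr_eq_trace, h1, Matrix.trace, Complex.re_sum]
  congr 1
  refine Finset.sum_congr rfl fun i _ => ?_
  rw [Matrix.diag_apply, Matrix.diagonal_mul, Complex.re_ofReal_mul]

lemma reTr_cfc_mul_cfc (g h : ℝ → ℝ) :
    reTr (cfc g A * cfc h B) = (d : ℝ)⁻¹ * ∑ i, ∑ j, overlap hA hB i j *
      (g (hA.eigenvalues i) * h (hB.eigenvalues j)) := by
  rw [reTr_cfc_mul hA]
  congr 1
  refine Finset.sum_congr rfl fun i _ => ?_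
  rw [diag_cfc_eigenbasis hA hB, Complex.ofReal_re, Finset.mul_sum]
  exact Finset.sum_congr rfl fun j _ => by ring

lemma reTr_cfc (g : ℝ → ℝ) :
    reTr (cfc g A) = (d : ℝ)⁻¹ * ∑ i, g (hA.eigenvalues i) := by
  have h1 := reTr_cfc_mul hA g 1
  rw [mul_one] at h1
  rw [h1]
  simp [Unitary.star_mul_self_of_mem hA.eigenvectorUnitary.2]

lemma diag_eigenbasis_self (i : Fin d) :
    (star (hA.eigenvectorUnitary : CMat d) * A * (hA.eigenvectorUnitary : CMat d)) i i =
      (hA.eigenvalues i : ℂ) := by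
  set U : CMat d := (hA.eigenvectorUnitary : CMat d) with hU
  have h0 : star U * U = 1 := Unitary.star_mul_self_of_mem hA.eigenvectorUnitary.2
  have h1 : star U * A * U = Matrix.diagonal (fun i => (hA.eigenvalues i : ℂ)) := by
    conv_lhs => rw [← cfc_id ℝ A hA.isSelfAdjoint]
    rw [cfc_eq_mul_diagonal_mul hA, ← hU]
    calc _ = (star U * U) * Matrix.diagonal (fun i => ((id (hA.eigenvalues i) : ℝ) : ℂ)) *
          (star U * U) := by simp only [mul_assoc]
      _ = _ := by rw [h0, one_mul, mul_one]; rfl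
  rw [h1, Matrix.diagonal_apply_eq]

end Overlap

/-! ### Convexity of trace functions and Klein's inequality. -/

/-- The trace function `A ↦ Re tr f(A)`. -/
def trFun (f : ℝ → ℝ) (A : CMat d) : ℝ := reTr (cfc f A)

/-- The positive semidefinite matrices. -/
def psdSet (d : ℕ) : Set (CMat d) := {A | A.PosSemidef}

lemma convex_psdSet : Convex ℝ (psdSet d) := by
  intro A hA B hB s t hs ht _
  exact Matrix.PosSemidef.add (Matrix.PosSemidef.smul hA hs) (Matrix.PosSemidef.smul hB ht)

lemma cfc_mul_self {A : CMat d} (hA : A.IsHermitian) (h : ℝ → ℝ) :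
    cfc h A * A = cfc (fun x => h x * x) A := by
  have hA' : IsSelfAdjoint A := hA
  -- On a finite spectrum every function is continuous, so `h` may be arbitrary.
  have hfin : (spectrum ℝ A).Finite := Matrix.finite_real_spectrum
  have h1 := cfc_mul h id A (hfin.continuousOn _) (hfin.continuousOn _)
  rw [cfc_id ℝ A hA'] at h1
  exact h1.symm

/-- **Peierls–Klein convexity**: the trace function of a convex function is convex. -/
lemma convexOn_trFun {φ : ℝ → ℝ} (hφ : ConvexOn ℝ (Set.Ici 0) φ) :
    ConvexOn ℝ (psdSet d) (trFun φ) := by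
  refine ⟨convex_psdSet, fun A hA B hB s t hs ht hst => ?_⟩
  have hC : (s • A + t • B).PosSemidef := convex_psdSet hA hB hs ht hst
  have hA' : A.PosSemidef := hA
  have hB' : B.PosSemidef := hB
  -- In the eigenbasis of the combination, a diagonal entry of `M` is an average of eigenvalues of
  -- `M`, so scalar Jensen applies.
  have key : ∀ {M : CMat d} (hM : M.PosSemidef) (k : Fin d),
      ∃ m : ℝ, 0 ≤ m ∧ m = ((star (hC.1.eigenvectorUnitary : CMat d) * M *
        (hC.1.eigenvectorUnitary : CMat d)) k k).re ∧
        φ m ≤ ∑ j, overlap hC.1 hM.1 k j * φ (hM.1.eigenvalues j) := by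
    intro M hM k
    have h1 := diag_cfc_eigenbasis hC.1 hM.1 id k
    rw [cfc_id ℝ M hM.1.isSelfAdjoint] at h1
    refine ⟨_, ?_, rfl, ?_⟩
    · rw [h1, Complex.ofReal_re]
      exact Finset.sum_nonneg fun j _ => mul_nonneg (overlap_nonneg _ _ _ _)
        (hM.eigenvalues_nonneg j)
    · rw [h1, Complex.ofReal_re]
      have := hφ.map_sum_le (t := Finset.univ) (w := fun j => overlap hC.1 hM.1 k j)
        (p := fun j => hM.1.eigenvalues j) (fun j _ => overlap_nonneg _ _ _ _)
        (sum_overlap _ _ _) (fun j _ => hM.eigenvalues_nonneg j)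
      simpa using this
  have hswap : ∀ {M : CMat d} (hM : M.PosSemidef),
      ∑ k, ∑ j, overlap hC.1 hM.1 k j * φ (hM.1.eigenvalues j) =
        ∑ j, φ (hM.1.eigenvalues j) := by
    intro M hM
    rw [Finset.sum_comm]
    refine Finset.sum_congr rfl fun j _ => ?_
    rw [← Finset.sum_mul, sum_overlap', one_mul]
  have hle : ∀ k, φ (hC.1.eigenvalues k) ≤
      s * ∑ j, overlap hC.1 hA'.1 k j * φ (hA'.1.eigenvalues j) +
      t * ∑ j, overlap hC.1 hB'.1 k j * φ (hB'.1.eigenvalues j) := by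
    intro k
    obtain ⟨a, ha0, ha, haφ⟩ := key hA' k
    obtain ⟨b, hb0, hb, hbφ⟩ := key hB' k
    have hc : hC.1.eigenvalues k = s * a + t * b := by
      have h1 := congrArg Complex.re (diag_eigenbasis_self hC.1 k)
      rw [Complex.ofReal_re] at h1
      rw [← h1, ha, hb]
      simp [mul_add, add_mul]
    rw [hc]
    refine (hφ.2 ha0 hb0 hs ht hst).trans ?_
    simp only [smul_eq_mul]
    gcongr
  rw [trFun, trFun, trFun, reTr_cfc hC.1, reTr_cfc hA'.1, reTr_cfc hB'.1, ← hswap hA', ← hswap hB',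
    smul_eq_mul, smul_eq_mul]
  calc _ ≤ (d : ℝ)⁻¹ * ∑ k, (s * ∑ j, overlap hC.1 hA'.1 k j * φ (hA'.1.eigenvalues j) +
      t * ∑ j, overlap hC.1 hB'.1 k j * φ (hB'.1.eigenvalues j)) := by
        gcongr with k; exact hle k
    _ = _ := by rw [Finset.sum_add_distrib, ← Finset.mul_sum, ← Finset.mul_sum]; ring

/-- The Bregman divergence of the trace function of `φ`. -/
def bregman (φ : ℝ → ℝ) (A B : CMat d) : ℝ :=
  trFun φ A - trFun φ B - reTr (cfc (deriv φ) B * (A - B))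

/-- The Bregman divergence as a spectral sum. -/
lemma bregman_eq_sum (φ : ℝ → ℝ) {A B : CMat d} (hA : A.IsHermitian) (hB : B.IsHermitian) :
    bregman φ A B = (d : ℝ)⁻¹ * ∑ i, ∑ j, overlap hB hA i j *
      (φ (hA.eigenvalues j) - φ (hB.eigenvalues i) -
        deriv φ (hB.eigenvalues i) * (hA.eigenvalues j - hB.eigenvalues i)) := by
  have e1 : trFun φ A = (d : ℝ)⁻¹ * ∑ i, ∑ j, overlap hB hA i j * φ (hA.eigenvalues j) := by
    rw [trFun, reTr_cfc hA, Finset.sum_comm]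
    congr 1
    exact Finset.sum_congr rfl fun j _ => by rw [← Finset.sum_mul, sum_overlap', one_mul]
  have e2 : ∀ g : ℝ → ℝ, reTr (cfc g B) =
      (d : ℝ)⁻¹ * ∑ i, ∑ j, overlap hB hA i j * g (hB.eigenvalues i) := by
    intro g
    rw [reTr_cfc hB]
    congr 1
    exact Finset.sum_congr rfl fun j _ => by rw [← Finset.sum_mul, sum_overlap, one_mul]
  have e3 : reTr (cfc (deriv φ) B * A) = (d : ℝ)⁻¹ * ∑ i, ∑ j, overlap hB hA i j *
      (deriv φ (hB.eigenvalues i) * hA.eigenvalues j) := by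
    conv_lhs => rw [← cfc_id ℝ A hA.isSelfAdjoint]
    exact reTr_cfc_mul_cfc hB hA (deriv φ) id
  rw [bregman, mul_sub, map_sub, cfc_mul_self hB, e1, trFun, e2, e2, e3, ← mul_sub, ← mul_sub,
    ← mul_sub]
  congr 1
  simp only [← Finset.sum_sub_distrib]
  exact Finset.sum_congr rfl fun i _ => Finset.sum_congr rfl fun j _ => by ring

/-- **Klein's inequality**. -/
lemma bregman_nonneg {φ : ℝ → ℝ} (hφ : ConvexOn ℝ (Set.Ici 0) φ)
    (hd : ∀ t, 0 < t → DifferentiableAt ℝ φ t) {A B : CMat d} (hA : A.PosSemidef)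
    (hB : B.PosDef) : 0 ≤ bregman φ A B := by
  rw [bregman_eq_sum φ hA.1 hB.1]
  refine mul_nonneg (by positivity) (Finset.sum_nonneg fun i _ => Finset.sum_nonneg fun j _ =>
    mul_nonneg (overlap_nonneg _ _ _ _) ?_)
  have hb : 0 < hB.1.eigenvalues i := hB.eigenvalues_pos i
  have ha : 0 ≤ hA.1.eigenvalues j := hA.eigenvalues_nonneg j
  generalize hB.1.eigenvalues i = b at *
  generalize hA.1.eigenvalues j = a at *
  -- The scalar graph lies above its tangent at `b`; only `b` has to be positive, `a` may be 0.
  rcases lt_trichotomy a b with h | rfl | h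
  · have := hφ.slope_le_deriv (x := a) (y := b) ha hb.le h (hd b hb)
    rw [slope_def_field, div_le_iff₀ (by linarith)] at this
    linarith
  · simp
  · have := hφ.deriv_le_slope (x := b) (y := a) hb.le ha h (hd b hb)
    rw [slope_def_field, le_div_iff₀ (by linarith)] at this
    linarith

/-! ### Continuity of matrix functions; matrices bounded below. -/

/-- Near `A` all spectra lie in one compact part of `t`, cut out by a ball whose radius is
controlled by the norm. The factor ‖1‖ keeps the bound valid for d = 0, where it vanishes. -/
lemma continuousOn_cfc_of_spectrum_subset {t : Set ℝ} (ht : IsClosed t) {g : ℝ → ℝ}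
    (hg : ContinuousOn g t) :
    ContinuousOn (fun A : CMat d => cfc g A) {A | A.IsHermitian ∧ spectrum ℝ A ⊆ t} := by
  refine ContinuousOn.cfc (p := IsSelfAdjoint)
    (s := fun A : CMat d => t ∩ Metric.closedBall 0 ((‖A‖ + 1) * ‖(1 : CMat d)‖)) g ?_
    continuousOn_id ?_ ?_ ?_
  · exact fun A _ => (isCompact_closedBall _ _).inter_left ht
  · intro A _
    have h1 : ∀ᶠ B in nhdsWithin A {A | A.IsHermitian ∧ spectrum ℝ A ⊆ t}, ‖B‖ < ‖A‖ + 1 :=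
      (continuous_norm.continuousWithinAt.eventually_lt_const (by linarith))
    filter_upwards [h1, self_mem_nhdsWithin] with B hB hBt
    refine Set.subset_inter hBt.2 ((spectrum.subset_closedBall_norm_mul B).trans
      (Metric.closedBall_subset_closedBall ?_))
    gcongr
  · exact fun A hA => hA.1.isSelfAdjoint
  · exact fun A _ => hg.mono Set.inter_subset_left

/-- The matrices that dominate `ε` times the identity. -/
def aboveSet (d : ℕ) (ε : ℝ) : Set (CMat d) := {A | (A - ε • (1 : CMat d)).PosSemidef}

open scoped MatrixOrder in
lemma isClosed_psdSet : IsClosed (psdSet d) := by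
  have : psdSet d = {A | 0 ≤ A} := by ext A; exact Matrix.nonneg_iff_posSemidef.symm
  rw [this]
  exact CStarAlgebra.isClosed_nonneg

lemma isClosed_aboveSet (ε : ℝ) : IsClosed (aboveSet d ε) :=
  isClosed_psdSet.preimage (continuous_id.sub continuous_const)

lemma convex_aboveSet (ε : ℝ) : Convex ℝ (aboveSet d ε) := by
  intro A hA B hB s t hs ht hst
  have := convex_psdSet (d := d) hA hB hs ht hst
  have h2 : s • (A - ε • 1) + t • (B - ε • 1) = s • A + t • B - ε • (1 : CMat d) := by
    rw [smul_sub, smul_sub, smul_comm s ε, smul_comm t ε]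
    have : ε • (1 : CMat d) = ε • s • (1 : CMat d) + ε • t • (1 : CMat d) := by
      rw [← smul_add, ← add_smul, hst, one_smul]
    rw [this]; abel
  rw [h2] at this
  exact this

lemma posSemidef_of_mem_aboveSet {ε : ℝ} (hε : 0 ≤ ε) {A : CMat d} (hA : A ∈ aboveSet d ε) :
    A.PosSemidef := by
  have h : A = (A - ε • 1) + ε • (1 : CMat d) := by abel
  rw [h]
  exact Matrix.PosSemidef.add hA (Matrix.PosSemidef.one.smul hε)

lemma posDef_of_mem_aboveSet {ε : ℝ} (hε : 0 < ε) {A : CMat d} (hA : A ∈ aboveSet d ε) :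
    A.PosDef := by
  have h : A = (A - ε • 1) + ε • (1 : CMat d) := by abel
  rw [h]
  exact Matrix.PosDef.posSemidef_add hA (Matrix.PosDef.one.smul hε)

open scoped MatrixOrder in
lemma mem_aboveSet_iff {ε : ℝ} {A : CMat d} :
    A ∈ aboveSet d ε ↔ A.IsHermitian ∧ spectrum ℝ A ⊆ Set.Ici ε := by
  have h0 : A ∈ aboveSet d ε ↔ algebraMap ℝ (CMat d) ε ≤ A := by
    rw [Algebra.algebraMap_eq_smul_one]; rfl
  constructor
  · intro h
    have hA : A.IsHermitian := by
      have h1 : A = (A - ε • 1) + ε • (1 : CMat d) := by abel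
      rw [h1]
      exact (show (A - ε • 1).PosSemidef from h).1.add
        (by rw [Matrix.IsHermitian, Matrix.conjTranspose_smul]; simp)
    exact ⟨hA, (algebraMap_le_iff_le_spectrum (a := A) (ha := hA.isSelfAdjoint)).1 (h0.1 h)⟩
  · rintro ⟨hA, h⟩
    exact h0.2 ((algebraMap_le_iff_le_spectrum (a := A) (ha := hA.isSelfAdjoint)).2 h)

lemma continuousOn_cfc_aboveSet {ε : ℝ} {g : ℝ → ℝ} (hg : ContinuousOn g (Set.Ici ε)) :
    ContinuousOn (fun A : CMat d => cfc g A) (aboveSet d ε) :=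
  (continuousOn_cfc_of_spectrum_subset isClosed_Ici hg).mono fun _ hA => mem_aboveSet_iff.1 hA

lemma aboveSet_zero : aboveSet d 0 = psdSet d := by
  ext A; simp [aboveSet, psdSet]

lemma continuousOn_trFun_psdSet {g : ℝ → ℝ} (hg : ContinuousOn g (Set.Ici 0)) :
    ContinuousOn (trFun (d := d) g) (psdSet d) := by
  rw [← aboveSet_zero]
  exact reTr.continuous.comp_continuousOn (continuousOn_cfc_aboveSet hg)

lemma exists_mem_aboveSet_of_posDef {A : CMat d} (hA : A.PosDef) :
    ∃ ε, 0 < ε ∧ A ∈ aboveSet d ε := by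
  have hfin : (spectrum ℝ A).Finite := Matrix.finite_real_spectrum
  have hpos : ∀ x ∈ spectrum ℝ A, 0 < x := by
    intro x hx
    rw [hA.1.spectrum_real_eq_range_eigenvalues] at hx
    obtain ⟨i, rfl⟩ := hx
    exact hA.eigenvalues_pos i
  obtain ⟨ε, hε, h⟩ : ∃ ε, 0 < ε ∧ ∀ x ∈ spectrum ℝ A, ε ≤ x := by
    rcases (spectrum ℝ A).eq_empty_or_nonempty with h | h
    · exact ⟨1, one_pos, by simp [h]⟩
    · obtain ⟨x, hx, hmin⟩ := Set.exists_min_image _ id hfin h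
      exact ⟨x, hpos x hx, hmin⟩
  exact ⟨ε, hε, mem_aboveSet_iff.2 ⟨hA.1, h⟩⟩

-- Since B - A ≥ -‖B - A‖ · 1, the matrix `B` dominates the positive multiple ε - ‖B - A‖ of the
-- identity. This makes the positive definite cone open among Hermitian matrices.
open scoped MatrixOrder in
lemma posDef_of_norm_sub_lt {ε : ℝ} {A B : CMat d} (hA : A ∈ aboveSet d ε) (hB : B.IsHermitian)
    (h : ‖B - A‖ < ε) : B.PosDef := by
  have hsa : IsSelfAdjoint (B - A) := (hB.sub (mem_aboveSet_iff.1 hA).1).isSelfAdjoint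
  have h1 : -algebraMap ℝ (CMat d) ‖B - A‖ ≤ B - A := hsa.neg_algebraMap_norm_le_self
  have h2 : (B - A - -algebraMap ℝ (CMat d) ‖B - A‖).PosSemidef := h1
  rw [Algebra.algebraMap_eq_smul_one] at h2
  refine posDef_of_mem_aboveSet (ε := ε - ‖B - A‖) (by linarith) ?_
  have h3 := Matrix.PosSemidef.add (show (A - ε • (1 : CMat d)).PosSemidef from hA) h2
  have h4 : A - ε • 1 + (B - A - -(‖B - A‖ • 1)) = B - (ε - ‖B - A‖) • (1 : CMat d) := by
    rw [sub_smul]; abel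
  rw [h4] at h3
  exact h3

/-! ### Hermitian matrices as a real space with the trace pairing. -/

/-- The inclusion of Hermitian matrices into all matrices. -/
def hermIncl (d : ℕ) : Herm d →L[ℝ] CMat d := (selfAdjoint.submodule ℝ (CMat d)).subtypeL

instance : FiniteDimensional ℝ (Herm d) :=
  inferInstanceAs (FiniteDimensional ℝ (selfAdjoint.submodule ℝ (CMat d)))

lemma hermIncl_apply (A : Herm d) : hermIncl d A = (A : CMat d) := rfl

lemma Herm.isHermitian (A : Herm d) : (hermIncl d A).IsHermitian := A.2

lemma norm_hermIncl (A : Herm d) : ‖hermIncl d A‖ = ‖A‖ := rfl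

/-- The real trace pairing on Hermitian matrices. -/
def hermPair (d : ℕ) : Herm d →L[ℝ] Herm d →L[ℝ] ℝ :=
  (ContinuousLinearMap.compL ℝ (Herm d) (CMat d) ℝ reTr).comp
    ((ContinuousLinearMap.mul ℝ (CMat d)).bilinearComp (hermIncl d) (hermIncl d))

lemma hermPair_apply (A B : Herm d) :
    hermPair d A B = reTr (hermIncl d A * hermIncl d B) := rfl

lemma trInner_re (A B : Herm d) : (trInner (A : CMat d) (B : CMat d)).re = hermPair d A B := by
  rw [hermPair_apply, trInner, reTr_apply, ← hermIncl_apply, ← hermIncl_apply,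
    (Herm.isHermitian A).eq]

/-- The Hermitian positive definite matrices. -/
def hermPD (d : ℕ) : Set (Herm d) := {A | (hermIncl d A).PosDef}

lemma isOpen_hermPD : IsOpen (hermPD d) := by
  rw [Metric.isOpen_iff]
  intro A hA
  obtain ⟨ε, hε, hAε⟩ := exists_mem_aboveSet_of_posDef hA
  refine ⟨ε, hε, fun B hB => posDef_of_norm_sub_lt hAε (Herm.isHermitian B) ?_⟩
  rw [← map_sub, norm_hermIncl, ← dist_eq_norm]
  exact hB

lemma convex_hermPD : Convex ℝ (hermPD d) := by
  intro A hA B hB s t hs ht hst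
  have hA' : (hermIncl d A).PosDef := hA
  have hB' : (hermIncl d B).PosDef := hB
  show (hermIncl d (s • A + t • B)).PosDef
  rw [map_add, map_smul, map_smul]
  rcases hs.eq_or_lt with rfl | hs
  · rw [zero_add] at hst
    simpa [hst] using hB'
  · exact (hA'.smul hs).add_posSemidef (hB'.posSemidef.smul ht)

/-! ### Derivatives of the trace function and joint convexity of the divergence. -/

section Calculus

variable {φ : ℝ → ℝ} (hc : ConvexOn ℝ (Set.Ici 0) φ)
  (hd : ∀ t, 0 < t → DifferentiableAt ℝ φ t)
  (hψ : ∀ A ∈ hermPD d, DifferentiableAt ℝ (stdFun d (deriv φ)) A)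

lemma hermIncl_stdFun (g : ℝ → ℝ) (A : Herm d) :
    hermIncl d (stdFun d g A) = cfc g (hermIncl d A) := rfl

lemma bregman_hermIncl (A B : Herm d) :
    bregman φ (hermIncl d A) (hermIncl d B) = trFun φ (hermIncl d A) - trFun φ (hermIncl d B) -
      hermPair d (stdFun d (deriv φ) B) (A - B) := by
  rw [bregman, hermPair_apply, hermIncl_stdFun, map_sub]

-- The right side is D(A, B) + D(B, A), and the second summand is nonnegative by Klein's inequality.
include hc hd in
lemma bregman_hermIncl_le {A B : Herm d} (hA : A ∈ hermPD d) (hB : B ∈ hermPD d) :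
    bregman φ (hermIncl d A) (hermIncl d B) ≤
      hermPair d (stdFun d (deriv φ) A - stdFun d (deriv φ) B) (A - B) := by
  have h1 := bregman_nonneg hc hd (Matrix.PosDef.posSemidef hB) hA
  rw [bregman_hermIncl] at h1 ⊢
  have h2 : B - A = -(A - B) := by abel
  rw [h2, map_neg] at h1
  rw [map_sub (hermPair d), sub_apply]
  linarith

include hc hd hψ in
/-- The gradient of the trace function of `φ` is `φ'`. -/
lemma hasFDerivAt_trFun {A : Herm d} (hA : A ∈ hermPD d) :
    HasFDerivAt (fun B => trFun φ (hermIncl d B)) (hermPair d (stdFun d (deriv φ) A)) A := by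
  -- The remainder is the Bregman divergence itself. It lies between 0 and ⟨ψ(C) - ψ(A), C - A⟩,
  -- which is o(‖C - A‖) because ψ is continuous at `A`.
  rw [hasFDerivAt_iff_isLittleO, Asymptotics.isLittleO_iff]
  intro c hcpos
  have hcont : Filter.Tendsto
      (fun C => ‖hermPair d (stdFun d (deriv φ) C - stdFun d (deriv φ) A)‖) (nhds A) (nhds 0) := by
    have h1 : ContinuousAt
        (fun C => ‖hermPair d (stdFun d (deriv φ) C - stdFun d (deriv φ) A)‖) A :=
      (((hermPair d).continuous.continuousAt).comp
        ((hψ A hA).continuousAt.sub continuousAt_const)).norm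
    have h2 := h1.tendsto
    simpa using h2
  filter_upwards [hcont.eventually_lt_const hcpos, isOpen_hermPD.mem_nhds hA] with C h1 hC
  have h2 := bregman_nonneg hc hd (Matrix.PosDef.posSemidef hC) hA
  have h3 := bregman_hermIncl_le hc hd hC hA
  rw [← bregman_hermIncl, Real.norm_of_nonneg h2]
  refine h3.trans ((Real.le_norm_self _).trans ?_)
  exact (ContinuousLinearMap.le_opNorm _ _).trans (by gcongr)

-- Dψ is the second derivative of the trace function, hence symmetric.
include hc hd hψ in
lemma hermPair_fderiv_symm {A : Herm d} (hA : A ∈ hermPD d) (H K : Herm d) :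
    hermPair d (fderiv ℝ (stdFun d (deriv φ)) A H) K =
      hermPair d (fderiv ℝ (stdFun d (deriv φ)) A K) H := by
  have h1 : ∀ᶠ B in nhds A, HasFDerivAt (fun B => trFun φ (hermIncl d B))
      (hermPair d (stdFun d (deriv φ) B)) B := by
    filter_upwards [isOpen_hermPD.mem_nhds hA] with B hB
    exact hasFDerivAt_trFun hc hd hψ hB
  have h2 : HasFDerivAt (fun B => hermPair d (stdFun d (deriv φ) B))
      ((hermPair d).comp (fderiv ℝ (stdFun d (deriv φ)) A)) A :=
    (hermPair d).hasFDerivAt.comp A (hψ A hA).hasFDerivAt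
  exact second_derivative_symmetric_of_eventually h1 h2 H K

include hψ in
lemma hasDerivAt_hermPair_stdFun {A H : Herm d} (K : Herm d) {s : ℝ} (hA : A + s • H ∈ hermPD d) :
    HasDerivAt (fun s : ℝ => hermPair d (stdFun d (deriv φ) (A + s • H)) K)
      (hermPair d (fderiv ℝ (stdFun d (deriv φ)) (A + s • H) H) K) s := by
  have h1 : HasDerivAt (fun s : ℝ => A + s • H) H s := by
    simpa using ((hasDerivAt_id s).smul_const H).const_add A
  have h2 := (hψ _ hA).hasFDerivAt.comp_hasDerivAt s h1
  have h3 := ((hermPair d).flip K).hasFDerivAt.comp_hasDerivAt s h2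
  exact h3

-- The gradient ψ of a convex function is monotone: ⟨ψ(A + sH) - ψ(A), sH⟩ ≥ 0. Dividing by s²,
-- which handles both signs of s, and letting s tend to 0 gives the claim.
include hc hd hψ in
lemma hermPair_fderiv_nonneg {A : Herm d} (hA : A ∈ hermPD d) (H : Herm d) :
    0 ≤ hermPair d (fderiv ℝ (stdFun d (deriv φ)) A H) H := by
  have hA0 : A + (0 : ℝ) • H ∈ hermPD d := by simpa using hA
  have h1 := hasDerivAt_hermPair_stdFun hψ H hA0
  rw [zero_smul, add_zero] at h1
  have h2 := hasDerivAt_iff_tendsto_slope.1 h1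
  refine ge_of_tendsto h2 ?_
  have h3 : ∀ᶠ s : ℝ in nhds 0, A + s • H ∈ hermPD d := by
    have : ContinuousAt (fun s : ℝ => A + s • H) 0 := by fun_prop
    exact this.eventually_mem (isOpen_hermPD.mem_nhds hA0)
  filter_upwards [h3.filter_mono nhdsWithin_le_nhds, self_mem_nhdsWithin] with s hs hs0
  have h4 := (bregman_nonneg hc hd (Matrix.PosDef.posSemidef hs) hA).trans
    (bregman_hermIncl_le hc hd hs hA)
  have h5 : A + s • H - A = s • H := by abel
  rw [h5, map_smul, map_sub, sub_apply, smul_eq_mul] at h4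
  rw [slope_def_field, zero_smul, add_zero, sub_zero]
  have hs0' : s ≠ 0 := hs0
  have h6 : (hermPair d (stdFun d (deriv φ) (A + s • H)) H -
      hermPair d (stdFun d (deriv φ) A) H) / s =
      (s * (hermPair d (stdFun d (deriv φ) (A + s • H)) H -
      hermPair d (stdFun d (deriv φ) A) H)) / s ^ 2 := by field_simp
  rw [h6]
  positivity

include hc hd hψ in
/-- The variational inequality `⟨H, S H⟩ ≥ 2⟨H, K⟩ - ⟨K, S⁻¹ K⟩` for `S = Dψ(A)`. -/
lemma two_mul_sub_le_hermPair_fderiv {A : Herm d} (hA : A ∈ hermPD d)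
    (hinv : (fderiv ℝ (stdFun d (deriv φ)) A).IsInvertible) (H K : Herm d) :
    2 * hermPair d K H - hermPair d K ((fderiv ℝ (stdFun d (deriv φ)) A).inverse K) ≤
      hermPair d (fderiv ℝ (stdFun d (deriv φ)) A H) H := by
  set S := fderiv ℝ (stdFun d (deriv φ)) A
  set J := S.inverse K
  have hJ : S J = K := hinv.self_apply_inverse K
  -- Completing the square: expand the form at H - S⁻¹K; symmetry of `S` merges the cross terms.
  have h1 : 0 ≤ hermPair d (S (H - J)) (H - J) := hermPair_fderiv_nonneg hc hd hψ hA (H - J)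
  have h2 : hermPair d (S H) J = hermPair d (S J) H := hermPair_fderiv_symm hc hd hψ hA H J
  simp only [map_sub, sub_apply, h2, hJ] at h1
  linarith

variable (hinv : ∀ A ∈ hermPD d, (fderiv ℝ (stdFun d (deriv φ)) A).IsInvertible)
  (hconc : ∀ A ∈ hermPD d, ∀ B ∈ hermPD d, ∀ α : ℝ, 0 ≤ α → α ≤ 1 →
    OpLE
      (α • (fderiv ℝ (stdFun d (deriv φ)) A).inverse +
        (1 - α) • (fderiv ℝ (stdFun d (deriv φ)) B).inverse)
      (fderiv ℝ (stdFun d (deriv φ)) (α • A + (1 - α) • B)).inverse)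

include hc hd hψ hinv hconc in
/-- Joint convexity of the second derivative `(A, H) ↦ ⟨H, Dψ(A) H⟩`. -/
lemma hermPair_fderiv_jointly_convex {A B : Herm d} (hA : A ∈ hermPD d) (hB : B ∈ hermPD d)
    (H K : Herm d) {s t : ℝ} (hs : 0 ≤ s) (ht : 0 ≤ t) (hst : s + t = 1) :
    hermPair d (fderiv ℝ (stdFun d (deriv φ)) (s • A + t • B) (s • H + t • K)) (s • H + t • K) ≤
      s * hermPair d (fderiv ℝ (stdFun d (deriv φ)) A H) H +
        t * hermPair d (fderiv ℝ (stdFun d (deriv φ)) B K) K := by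
  obtain rfl : t = 1 - s := by linarith
  have hC : s • A + (1 - s) • B ∈ hermPD d := convex_hermPD hA hB hs ht hst
  set L := s • H + (1 - s) • K with hL
  set S := fderiv ℝ (stdFun d (deriv φ)) (s • A + (1 - s) • B)
  -- The test vector `S L` is the optimal one at the intermediate point: there the variational bound
  -- equals ⟨S L, L⟩. The same vector is then used, suboptimally, at `A` and `B`.
  have h1 := (hconc A hA B hB s hs (by linarith)).2 (S L)
  rw [trInner_re] at h1
  simp only [sub_apply, add_apply,
    smul_apply, map_sub, map_add, map_smul, smul_eq_mul] at h1
  rw [(hinv _ hC).inverse_apply_self L] at h1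
  have h2 := mul_le_mul_of_nonneg_left
    (two_mul_sub_le_hermPair_fderiv hc hd hψ hA (hinv A hA) H (S L)) hs
  have h3 := mul_le_mul_of_nonneg_left
    (two_mul_sub_le_hermPair_fderiv hc hd hψ hB (hinv B hB) K (S L)) ht
  have h4 : hermPair d (S L) L = s * hermPair d (S L) H + (1 - s) * hermPair d (S L) K := by
    conv_lhs => rw [hL]
    rw [map_add, map_smul, map_smul, smul_eq_mul, smul_eq_mul]
  linarith

lemma add_smul_sub_mem_hermPD {A B : Herm d} (hA : A ∈ hermPD d) (hB : B ∈ hermPD d) {s : ℝ}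
    (hs : s ∈ Set.Icc (0 : ℝ) 1) : B + s • (A - B) ∈ hermPD d := by
  have h := convex_hermPD hB hA (sub_nonneg.2 hs.2) hs.1 (by ring)
  have h2 : (1 - s) • B + s • A = B + s • (A - B) := by
    rw [sub_smul, one_smul, smul_sub]; abel
  rwa [h2] at h

include hc hd hψ in
lemma hasDerivAt_bregman_segment {A B : Herm d} (hA : A ∈ hermPD d) (hB : B ∈ hermPD d) {s : ℝ}
    (hs : s ∈ Set.Icc (0 : ℝ) 1) :
    HasDerivAt (fun s : ℝ => bregman φ (hermIncl d (B + s • (A - B))) (hermIncl d B))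
      (hermPair d (stdFun d (deriv φ) (B + s • (A - B))) (A - B) -
        hermPair d (stdFun d (deriv φ) B) (A - B)) s := by
  have h1 : HasDerivAt (fun s : ℝ => B + s • (A - B)) (A - B) s := by
    simpa using ((hasDerivAt_id s).smul_const (A - B)).const_add B
  have h2 := (hasFDerivAt_trFun hc hd hψ (add_smul_sub_mem_hermPD hA hB hs)).comp_hasDerivAt s h1
  have h3 : (fun s : ℝ => bregman φ (hermIncl d (B + s • (A - B))) (hermIncl d B)) = fun s : ℝ =>
      trFun φ (hermIncl d (B + s • (A - B))) - trFun φ (hermIncl d B) -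
        s * hermPair d (stdFun d (deriv φ) B) (A - B) := by
    funext s
    rw [bregman_hermIncl, add_sub_cancel_left, map_smul, smul_eq_mul]
  rw [h3]
  have h4 := (h2.sub_const (trFun φ (hermIncl d B))).sub
    ((hasDerivAt_id s).mul_const (hermPair d (stdFun d (deriv φ) B) (A - B)))
  rw [one_mul] at h4
  exact h4

include hc hd hψ hinv hconc in
/-- Joint convexity of the Bregman divergence on positive definite Hermitian matrices. -/
lemma bregman_hermIncl_jointly_convex {A₀ B₀ A₁ B₁ : Herm d} (hA₀ : A₀ ∈ hermPD d)
    (hB₀ : B₀ ∈ hermPD d) (hA₁ : A₁ ∈ hermPD d) (hB₁ : B₁ ∈ hermPD d) {p q : ℝ} (hp : 0 ≤ p)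
    (hq : 0 ≤ q) (hpq : p + q = 1) :
    bregman φ (hermIncl d (p • A₀ + q • A₁)) (hermIncl d (p • B₀ + q • B₁)) ≤
      p * bregman φ (hermIncl d A₀) (hermIncl d B₀) +
        q * bregman φ (hermIncl d A₁) (hermIncl d B₁) := by
  set A := p • A₀ + q • A₁ with hAdef
  set B := p • B₀ + q • B₁ with hBdef
  have hA : A ∈ hermPD d := convex_hermPD hA₀ hA₁ hp hq hpq
  have hB : B ∈ hermPD d := convex_hermPD hB₀ hB₁ hp hq hpq
  have hAB : A - B = p • (A₀ - B₀) + q • (A₁ - B₁) := by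
    rw [hAdef, hBdef, smul_sub, smul_sub]; abel
  -- `u` is the convexity gap when each first argument moves from its second argument (s = 0) to its
  -- final place (s = 1). Since u(0) = u'(0) = 0 and u'' ≥ 0, the gap at s = 1 is nonnegative.
  set u : ℝ → ℝ := fun s =>
    p * bregman φ (hermIncl d (B₀ + s • (A₀ - B₀))) (hermIncl d B₀) +
      q * bregman φ (hermIncl d (B₁ + s • (A₁ - B₁))) (hermIncl d B₁) -
      bregman φ (hermIncl d (B + s • (A - B))) (hermIncl d B) with hu
  set g : Herm d → Herm d → ℝ → ℝ := fun A B s =>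
    hermPair d (stdFun d (deriv φ) (B + s • (A - B))) (A - B) -
        hermPair d (stdFun d (deriv φ) B) (A - B) with hg
  set u' : ℝ → ℝ := fun s => p * g A₀ B₀ s + q * g A₁ B₁ s - g A B s with hu'
  have hder : ∀ s ∈ Set.Icc (0 : ℝ) 1, HasDerivAt u (u' s) s := fun s hs =>
    (((hasDerivAt_bregman_segment hc hd hψ hA₀ hB₀ hs).const_mul p).add
      ((hasDerivAt_bregman_segment hc hd hψ hA₁ hB₁ hs).const_mul q)).sub
      (hasDerivAt_bregman_segment hc hd hψ hA hB hs)
  have hderg : ∀ {A B : Herm d}, A ∈ hermPD d → B ∈ hermPD d → ∀ s ∈ Set.Icc (0 : ℝ) 1,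
      HasDerivAt (g A B)
        (hermPair d (fderiv ℝ (stdFun d (deriv φ)) (B + s • (A - B)) (A - B)) (A - B)) s :=
    fun hA hB s hs => (hasDerivAt_hermPair_stdFun hψ _
      (add_smul_sub_mem_hermPD hA hB hs)).sub_const _
  have hder' : ∀ s ∈ Set.Icc (0 : ℝ) 1, ∃ v, 0 ≤ v ∧ HasDerivAt u' v s := by
    intro s hs
    refine ⟨_, ?_, (((hderg hA₀ hB₀ s hs).const_mul p).add
      ((hderg hA₁ hB₁ s hs).const_mul q)).sub (hderg hA hB s hs)⟩
    -- Joint convexity of the second derivative is exactly the nonnegativity of u''.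
    have h1 := hermPair_fderiv_jointly_convex hc hd hψ hinv hconc
      (add_smul_sub_mem_hermPD hA₀ hB₀ hs) (add_smul_sub_mem_hermPD hA₁ hB₁ hs)
      (A₀ - B₀) (A₁ - B₁) hp hq hpq
    have h2 : p • (B₀ + s • (A₀ - B₀)) + q • (B₁ + s • (A₁ - B₁)) = B + s • (A - B) := by
      rw [hAB, hBdef, smul_add, smul_add, smul_add, smul_comm p s, smul_comm q s]
      abel
    rw [h2, ← hAB] at h1
    linarith
  have hmono' : MonotoneOn u' (Set.Icc 0 1) := by
    refine monotoneOn_of_deriv_nonneg (convex_Icc 0 1) ?_ ?_ ?_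
    · intro s hs
      obtain ⟨v, -, hv⟩ := hder' s hs
      exact hv.continuousAt.continuousWithinAt
    · intro s hs
      obtain ⟨v, -, hv⟩ := hder' s (interior_subset hs)
      exact hv.differentiableAt.differentiableWithinAt
    · intro s hs
      obtain ⟨v, hv0, hv⟩ := hder' s (interior_subset hs)
      rwa [hv.deriv]
  have hu'0 : u' 0 = 0 := by simp [hu', hg]
  have hmono : MonotoneOn u (Set.Icc 0 1) := by
    refine monotoneOn_of_deriv_nonneg (convex_Icc 0 1) ?_ ?_ ?_
    · exact fun s hs => (hder s hs).continuousAt.continuousWithinAt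
    · exact fun s hs => (hder s (interior_subset hs)).differentiableAt.differentiableWithinAt
    · intro s hs
      rw [(hder s (interior_subset hs)).deriv, ← hu'0]
      exact hmono' (by simp) (interior_subset hs) (interior_subset hs).1
  have h01 := hmono (a := 0) (b := 1) (by simp) (by simp) zero_le_one
  have hself : ∀ C : Herm d, bregman φ (hermIncl d C) (hermIncl d C) = 0 := fun C => by
    simp [bregman]
  simp only [hu, zero_smul, add_zero, one_smul, add_sub_cancel, hself, mul_zero, sub_zero] at h01
  linarith

end Calculus

/-! ### Joint convexity of the divergence for the entropy classes. -/

/-- What the entropy inequality uses about `φ`. -/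
structure BregmanConvex (d : ℕ) (φ : ℝ → ℝ) : Prop where
  continuousOn : ContinuousOn φ (Set.Ici 0)
  convexOn : ConvexOn ℝ (Set.Ici 0) φ
  differentiableAt : ∀ t, 0 < t → DifferentiableAt ℝ φ t
  continuousOn_deriv : ContinuousOn (deriv φ) (Set.Ioi 0)
  -- The domain stays away from the possible singularity of φ' at 0 and is closed, as conditional
  -- Jensen requires.
  bregman_convexOn : ∀ ε, 0 < ε → ConvexOn ℝ (aboveSet d ε ×ˢ aboveSet d ε)
    (fun p => bregman φ p.1 p.2)

lemma deriv_eq_of_affine {φ : ℝ → ℝ} {a b : ℝ} (h : ∀ t, 0 ≤ t → φ t = a * t + b) {t : ℝ}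
    (ht : 0 < t) : HasDerivAt φ a t := by
  have h1 : HasDerivAt (fun t => a * t + b) a t := by
    simpa using ((hasDerivAt_id t).const_mul a).add_const b
  refine h1.congr_of_eventuallyEq ?_
  filter_upwards [Ioi_mem_nhds ht] with x hx using h x (le_of_lt hx)

lemma bregmanConvex_of_affine {φ : ℝ → ℝ} {a b : ℝ} (h : ∀ t, 0 ≤ t → φ t = a * t + b) :
    BregmanConvex d φ where
  continuousOn := ContinuousOn.congr (f := fun t => a * t + b) (by fun_prop) fun t ht => h t ht
  convexOn := by
    refine ⟨convex_Ici 0, fun x hx y hy s t hs ht hst => ?_⟩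
    have := convex_Ici (0 : ℝ) hx hy hs ht hst
    rw [h _ this, h x hx, h y hy]
    simp only [smul_eq_mul]
    have hb : b = s * b + t * b := by rw [← add_mul, hst, one_mul]
    nlinarith
  differentiableAt t ht := (deriv_eq_of_affine h ht).differentiableAt
  continuousOn_deriv := continuousOn_const.congr fun t ht => (deriv_eq_of_affine h ht).deriv
  bregman_convexOn ε hε := by
    have hconv := (convex_aboveSet (d := d) ε).prod (convex_aboveSet (d := d) ε)
    have h0 : ∀ p ∈ aboveSet d ε ×ˢ aboveSet d ε, bregman φ p.1 p.2 = 0 := by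
      rintro ⟨A, B⟩ ⟨hA, hB⟩
      have hA' := posSemidef_of_mem_aboveSet hε.le hA
      have hB' := posDef_of_mem_aboveSet hε hB
      rw [bregman_eq_sum φ hA'.1 hB'.1]
      refine mul_eq_zero_of_right _ (Finset.sum_eq_zero fun i _ => Finset.sum_eq_zero fun j _ => ?_)
      rw [h _ (hA'.eigenvalues_nonneg j), h _ (hB'.eigenvalues_pos i).le,
        (deriv_eq_of_affine h (hB'.eigenvalues_pos i)).deriv]
      ring
    refine ⟨hconv, fun x hx y hy s t hs ht hst => ?_⟩
    simp only
    rw [h0 x hx, h0 y hy, h0 _ (hconv hx hy hs ht hst)]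
    simp

/-- Every member of `Φ_d` has a jointly convex Bregman divergence in dimension `d`. -/
lemma bregmanConvex_of_mem_phiClass {φ : ℝ → ℝ} (hφ : φ ∈ PhiClass d) : BregmanConvex d φ := by
  rcases hφ with ⟨a, b, h⟩ | ⟨h1, h2, h3, h4, h5⟩
  · exact bregmanConvex_of_affine h
  have hd : ∀ t, 0 < t → DifferentiableAt ℝ φ t := fun t ht =>
    ((h3.differentiableOn (by norm_num)) t ht).differentiableAt (Ioi_mem_nhds ht)
  refine ⟨h1, h2, hd, h3.continuousOn_deriv_of_isOpen isOpen_Ioi (by norm_num), fun ε hε => ?_⟩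
  refine ⟨(convex_aboveSet ε).prod (convex_aboveSet ε), ?_⟩
  rintro ⟨A₀, B₀⟩ ⟨hA₀, hB₀⟩ ⟨A₁, B₁⟩ ⟨hA₁, hB₁⟩ s t hs ht hst
  have key : ∀ {A : CMat d}, A ∈ aboveSet d ε → ∃ A' ∈ hermPD d, hermIncl d A' = A := fun hA =>
    ⟨⟨_, (mem_aboveSet_iff.1 hA).1⟩, posDef_of_mem_aboveSet hε hA, rfl⟩
  obtain ⟨A₀, hA₀', rfl⟩ := key hA₀
  obtain ⟨B₀, hB₀', rfl⟩ := key hB₀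
  obtain ⟨A₁, hA₁', rfl⟩ := key hA₁
  obtain ⟨B₁, hB₁', rfl⟩ := key hB₁
  have := bregman_hermIncl_jointly_convex h2 hd (fun A hA => (h4 A hA).1)
    (fun A hA => (h4 A hA).2) (fun A hA B hB => h5 A B hA hB) hA₀' hB₀' hA₁' hB₁' hs ht hst
  simpa only [map_add, map_smul, smul_eq_mul, Prod.smul_mk, Prod.mk_add_mk] using this

/-- Every matrix entropy has a jointly convex Bregman divergence in every dimension. -/
lemma bregmanConvex_of_mem_phiInf {φ : ℝ → ℝ} (hφ : φ ∈ PhiInf) : BregmanConvex d φ := by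
  rcases Nat.eq_zero_or_pos d with rfl | hd
  -- The class constrains only d ≥ 1: for empty matrices the scalar regularity comes from d = 1 and
  -- the divergence vanishes.
  · obtain ⟨h1, h2, h3, h4, -⟩ := bregmanConvex_of_mem_phiClass (hφ 1 le_rfl)
    refine ⟨h1, h2, h3, h4, fun ε _ => ?_⟩
    have h0 : (fun p : CMat 0 × CMat 0 => bregman φ p.1 p.2) = fun _ => 0 := by
      funext p
      simp [bregman, trFun, reTr_apply, ntr]
    rw [h0]
    exact convexOn_const 0 ((convex_aboveSet ε).prod (convex_aboveSet ε))
  · exact bregmanConvex_of_mem_phiClass (hφ d hd)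

/-! ### Measurability of functions continuous on a closed set. -/

section Measurability

variable {Ω E F : Type*} {m m₀ : MeasurableSpace Ω} {μ : Measure[m₀] Ω}
  [NormedAddCommGroup E] [NormedAddCommGroup F]
  [SecondCountableTopology F]

/-- Matrix functions are controlled only on a closed set of matrices; extension by zero makes them
Borel everywhere. -/
lemma stronglyMeasurable_indicator_comp {s : Set E} (hs : IsClosed s) {g : E → F}
    (hg : ContinuousOn g s) {T : Ω → E} (hT : StronglyMeasurable[m] T) :
    StronglyMeasurable[m] (fun ω => s.indicator g (T ω)) := by
  classical
  borelize E F
  have h1 : Measurable (s.indicator g) := by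
    rw [← Set.piecewise_eq_indicator]
    exact hg.measurable_piecewise continuousOn_const hs.measurableSet
  exact (h1.comp hT.measurable).stronglyMeasurable

lemma aestronglyMeasurable_comp_of_continuousOn {s : Set E} (hs : IsClosed s) {g : E → F}
    (hg : ContinuousOn g s) {T : Ω → E} (hT : AEStronglyMeasurable[m₀] T μ)
    (hTs : ∀ᵐ ω ∂μ, T ω ∈ s) : AEStronglyMeasurable[m₀] (fun ω => g (T ω)) μ := by
  refine ⟨_, stronglyMeasurable_indicator_comp hs hg hT.stronglyMeasurable_mk, ?_⟩
  filter_upwards [hTs, hT.ae_eq_mk] with ω h1 h2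
  rw [← h2, Set.indicator_of_mem h1]

end Measurability

/-! ### Consequences of convexity for the trace function. -/

section Convexity

variable {φ : ℝ → ℝ}

lemma BregmanConvex.convexOn_trFun (h : BregmanConvex d φ) : ConvexOn ℝ (psdSet d) (trFun φ) :=
  MatrixEntropy.convexOn_trFun h.convexOn

lemma BregmanConvex.continuousOn_trFun (h : BregmanConvex d φ) :
    ContinuousOn (trFun φ) (psdSet d) := continuousOn_trFun_psdSet h.continuousOn

lemma BregmanConvex.bregman_nonneg (h : BregmanConvex d φ) {A B : CMat d} (hA : A.PosSemidef)
    (hB : B.PosDef) : 0 ≤ bregman φ A B :=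
  MatrixEntropy.bregman_nonneg h.convexOn h.differentiableAt hA hB

/-- The pairing `(A, B) ↦ Re tr (A B)`. -/
def trPair (d : ℕ) : CMat d →L[ℝ] CMat d →L[ℝ] ℝ :=
  (ContinuousLinearMap.compL ℝ (CMat d) (CMat d) ℝ reTr).comp (ContinuousLinearMap.mul ℝ (CMat d))

lemma trPair_apply (A B : CMat d) : trPair d A B = reTr (A * B) := rfl

/-- The trace function has an affine minorant. -/
lemma BregmanConvex.exists_affine_le (h : BregmanConvex d φ) :
    ∃ (c : ℝ) (l : CMat d →L[ℝ] ℝ), ∀ A ∈ psdSet d, c + l A ≤ trFun φ A := by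
  -- The minorant is the tangent at the identity, by Klein's inequality.
  refine ⟨trFun φ (1 : CMat d) - trPair d (cfc (deriv φ) 1) 1, trPair d (cfc (deriv φ) 1),
    fun A hA => ?_⟩
  have h1 := h.bregman_nonneg (A := A) (B := 1) hA Matrix.PosDef.one
  rw [bregman, mul_sub, map_sub, ← trPair_apply, ← trPair_apply] at h1
  linarith

lemma aboveSet_subset_psdSet {ε : ℝ} (hε : 0 ≤ ε) : aboveSet d ε ⊆ psdSet d :=
  fun _ hA => posSemidef_of_mem_aboveSet hε hA

lemma BregmanConvex.continuousOn_cfc_deriv (h : BregmanConvex d φ) {ε : ℝ} (hε : 0 < ε) :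
    ContinuousOn (fun A : CMat d => cfc (deriv φ) A) (aboveSet d ε) :=
  continuousOn_cfc_aboveSet (h.continuousOn_deriv.mono fun _ hx => lt_of_lt_of_le hε hx)

lemma BregmanConvex.continuousOn_bregman (h : BregmanConvex d φ) {ε : ℝ} (hε : 0 < ε) :
    ContinuousOn (fun p : CMat d × CMat d => bregman φ p.1 p.2)
      (aboveSet d ε ×ˢ aboveSet d ε) := by
  have h1 : ContinuousOn (trFun (d := d) φ) (aboveSet d ε) :=
    h.continuousOn_trFun.mono (aboveSet_subset_psdSet hε.le)
  have hfst : Set.MapsTo Prod.fst (aboveSet d ε ×ˢ aboveSet d ε) (aboveSet d ε) := fun _ hp => hp.1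
  have hsnd : Set.MapsTo Prod.snd (aboveSet d ε ×ˢ aboveSet d ε) (aboveSet d ε) := fun _ hp => hp.2
  exact ((h1.comp continuousOn_fst hfst).sub (h1.comp continuousOn_snd hsnd)).sub
    (reTr.continuous.comp_continuousOn
      (((h.continuousOn_cfc_deriv hε).comp continuousOn_snd hsnd).mul
        (continuousOn_fst.sub continuousOn_snd)))

end Convexity

/-! ### Bregman divergences and conditional expectations. -/

section Conditional

variable {Ω : Type*} {m m₀ : MeasurableSpace Ω} {μ : Measure[m₀] Ω} [IsProbabilityMeasure μ]
  {φ : ℝ → ℝ}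

/-- Conditional expectations inherit the integrability of the trace function. -/
lemma BregmanConvex.integrable_trFun_condExp (h : BregmanConvex d φ) (hm : m ≤ m₀)
    {W : Ω → CMat d} (hW : Integrable W μ) (hpsd : ∀ᵐ ω ∂μ, W ω ∈ psdSet d)
    (hf : Integrable (fun ω => trFun φ (W ω)) μ) :
    Integrable (fun ω => trFun φ ((μ[W | m]) ω)) μ := by
  have hT : ∀ᵐ ω ∂μ, (μ[W | m]) ω ∈ psdSet d :=
    convex_psdSet.condExp_mem hm hW isClosed_psdSet hpsd
  obtain ⟨c, l, hcl⟩ := h.exists_affine_le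
  -- The affine minorant bounds from below, conditional Jensen from above.
  refine integrable_of_le_of_le (g₁ := fun ω => c + l ((μ[W | m]) ω))
    (g₂ := μ[trFun φ ∘ W | m]) ?_ ?_ ?_ ?_ integrable_condExp
  · exact aestronglyMeasurable_comp_of_continuousOn isClosed_psdSet h.continuousOn_trFun
      integrable_condExp.aestronglyMeasurable hT
  · filter_upwards [hT] with ω hω using hcl _ hω
  · exact h.convexOn_trFun.map_condExp_le hm h.continuousOn_trFun.lowerSemicontinuousOn hpsd
      isClosed_psdSet hW hf
  · exact (integrable_const c).add (l.integrable_comp integrable_condExp)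

/-- Pull-out for a bounded factor: `𝔼⟨P, W - 𝔼[W | m]⟩ = 0`. -/
lemma integral_trPair_sub_condExp (hm : m ≤ m₀) {W : Ω → CMat d} (hW : Integrable W μ)
    {P : Ω → CMat d} (hP : StronglyMeasurable[m] P) {M : ℝ} (hPM : ∀ ω, ‖P ω‖ ≤ M) :
    Integrable (fun ω => trPair d (P ω) (W ω - (μ[W | m]) ω)) μ ∧
      ∫ ω, trPair d (P ω) (W ω - (μ[W | m]) ω) ∂μ = 0 := by
  have hint : ∀ {V : Ω → CMat d}, Integrable V μ → Integrable (fun ω => trPair d (P ω) (V ω)) μ := by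
    intro V hV
    refine Integrable.mono' (hV.norm.const_mul (‖trPair d‖ * M))
      ((trPair d).aestronglyMeasurable_comp₂ (hP.mono hm).aestronglyMeasurable
        hV.aestronglyMeasurable) (Filter.Eventually.of_forall fun ω => ?_)
    refine ((trPair d).le_opNorm₂ _ _).trans ?_
    gcongr
    exact hPM ω
  have h1 : ∫ ω, trPair d (P ω) (W ω) ∂μ = ∫ ω, trPair d (P ω) ((μ[W | m]) ω) ∂μ := by
    rw [← integral_condExp hm]
    exact integral_congr_ae (condExp_bilin_of_stronglyMeasurable_left (trPair d) hP (hint hW) hW)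
  simp only [map_sub]
  refine ⟨(hint hW).sub (hint integrable_condExp), ?_⟩
  rw [integral_sub (hint hW) (hint integrable_condExp), h1, sub_self]

/-- The expected Bregman divergence from the conditional expectation. -/
lemma BregmanConvex.integral_bregman_condExp (h : BregmanConvex d φ) (hm : m ≤ m₀) {ε : ℝ}
    (hε : 0 < ε) {W : Ω → CMat d} (hW : Integrable W μ) (hWε : ∀ᵐ ω ∂μ, W ω ∈ aboveSet d ε)
    (hf : Integrable (fun ω => trFun φ (W ω)) μ) :
    Integrable (fun ω => bregman φ (W ω) ((μ[W | m]) ω)) μ ∧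
      ∫ ω, bregman φ (W ω) ((μ[W | m]) ω) ∂μ =
        ∫ ω, trFun φ (W ω) ∂μ - ∫ ω, trFun φ ((μ[W | m]) ω) ∂μ := by
  set T := μ[W | m] with hTdef
  have hWpsd : ∀ᵐ ω ∂μ, W ω ∈ psdSet d := hWε.mono fun _ hω => aboveSet_subset_psdSet hε.le hω
  have hTε : ∀ᵐ ω ∂μ, T ω ∈ aboveSet d ε :=
    (convex_aboveSet ε).condExp_mem hm hW (isClosed_aboveSet ε) hWε
  have hTm : StronglyMeasurable[m] T := stronglyMeasurable_condExp
  have hfT : Integrable (fun ω => trFun φ (T ω)) μ := h.integrable_trFun_condExp hm hW hWpsd hf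
  have hdiff : Integrable (fun ω => trFun φ (W ω) - trFun φ (T ω)) μ := hf.sub hfT
  -- The factor φ'(T) need not be bounded, so the linear term is not known to be integrable. On the
  -- `m`-measurable set ‖T‖ ≤ N it is bounded by compactness, and its integral there vanishes by
  -- pull-out.
  set C : ℕ → Set Ω := fun N => {ω | ‖T ω‖ ≤ N} with hC
  have hCm : ∀ N, MeasurableSet[m] (C N) := fun N =>
    hTm.norm.measurableSet_le stronglyMeasurable_const
  have hcover : AECover μ Filter.atTop C := by
    refine ⟨Filter.Eventually.of_forall fun ω => ?_, fun N => hm _ (hCm N)⟩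
    obtain ⟨N, hN⟩ := exists_nat_ge ‖T ω‖
    filter_upwards [Filter.eventually_ge_atTop N] with k hk
    exact hN.trans (by exact_mod_cast hk)
  have hloc : ∀ N, IntegrableOn (fun ω => bregman φ (W ω) (T ω)) (C N) μ ∧
      ∫ ω in C N, bregman φ (W ω) (T ω) ∂μ = ∫ ω in C N, (trFun φ (W ω) - trFun φ (T ω)) ∂μ := by
    intro N
    set s : Set (CMat d) := aboveSet d ε ∩ Metric.closedBall 0 N with hs
    have hscl : IsClosed s := (isClosed_aboveSet ε).inter Metric.isClosed_closedBall
    have hscont : ContinuousOn (fun A : CMat d => cfc (deriv φ) A) s :=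
      (h.continuousOn_cfc_deriv hε).mono Set.inter_subset_left
    obtain ⟨M, hM⟩ := ((isCompact_closedBall (0 : CMat d) N).inter_left
      (isClosed_aboveSet ε)).exists_bound_of_continuousOn hscont
    set P : Ω → CMat d := fun ω => s.indicator (fun A => cfc (deriv φ) A) (T ω) with hPdef
    have hP : StronglyMeasurable[m] P := stronglyMeasurable_indicator_comp hscl hscont hTm
    have hPM : ∀ ω, ‖P ω‖ ≤ max M 0 := by
      intro ω
      by_cases hω : T ω ∈ s
      · rw [hPdef]
        simp only [Set.indicator_of_mem hω]
        exact (hM _ hω).trans (le_max_left _ _)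
      · rw [hPdef]
        simp [Set.indicator_of_notMem hω]
    obtain ⟨hint, hzero⟩ := integral_trPair_sub_condExp hm hW hP hPM
    rw [← hTdef] at hint hzero
    have heq : (fun ω => bregman φ (W ω) (T ω)) =ᵐ[μ.restrict (C N)] fun ω =>
        (trFun φ (W ω) - trFun φ (T ω)) - trPair d (P ω) (W ω - T ω) := by
      filter_upwards [ae_restrict_of_ae hTε, ae_restrict_mem (hm _ (hCm N))] with ω h1 h2
      have h3 : T ω ∈ s := ⟨h1, by simpa [hC] using h2⟩
      rw [bregman, trPair_apply, hPdef]
      simp only [Set.indicator_of_mem h3]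
    have hzero' : ∫ ω in C N, trPair d (P ω) (W ω - T ω) ∂μ = 0 := by
      rw [setIntegral_eq_integral_of_forall_compl_eq_zero, hzero]
      intro ω hω
      have h3 : T ω ∉ s := fun h3 => hω (by simpa [hC] using h3.2)
      rw [hPdef]
      simp [Set.indicator_of_notMem h3]
    refine ⟨(hdiff.integrableOn.sub hint.integrableOn).congr heq.symm, ?_⟩
    rw [integral_congr_ae heq, integral_sub hdiff.integrableOn hint.integrableOn, hzero', sub_zero]
  have htend : Filter.Tendsto (fun N => ∫ ω in C N, bregman φ (W ω) (T ω) ∂μ) Filter.atTop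
      (nhds (∫ ω, (trFun φ (W ω) - trFun φ (T ω)) ∂μ)) := by
    simp only [fun N => (hloc N).2]
    exact hcover.integral_tendsto_of_countably_generated hdiff
  -- Since the divergence is nonnegative, convergence of the truncated integrals yields its
  -- integrability.
  have hbint := hcover.integrable_of_integral_tendsto_of_nonneg_ae _ (fun N => (hloc N).1)
    (by filter_upwards [hWpsd, hTε] with ω h1 h2 using
      h.bregman_nonneg h1 (posDef_of_mem_aboveSet hε h2)) htend
  exact ⟨hbint, by rw [hcover.integral_eq_of_tendsto _ hbint htend, integral_sub hf hfT]⟩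

/-- Four-term inequality for commuting conditional expectations, for matrices bounded below. -/
lemma BregmanConvex.four_term_of_aboveSet (h : BregmanConvex d φ) {G K : MeasurableSpace Ω}
    (hG : G ≤ m₀) (hK : K ≤ m₀) {ε : ℝ} (hε : 0 < ε) {W T V U : Ω → CMat d}
    (hW : Integrable W μ) (hWε : ∀ᵐ ω ∂μ, W ω ∈ aboveSet d ε)
    (hf : Integrable (fun ω => trFun φ (W ω)) μ)
    (hT : T =ᵐ[μ] μ[W | G]) (hV : V =ᵐ[μ] μ[W | K]) (hUT : U =ᵐ[μ] μ[T | K])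
    (hUV : U =ᵐ[μ] μ[V | G]) :
    ∫ ω, trFun φ (T ω) ∂μ + ∫ ω, trFun φ (V ω) ∂μ ≤
      ∫ ω, trFun φ (W ω) ∂μ + ∫ ω, trFun φ (U ω) ∂μ := by
  have hWpsd : ∀ᵐ ω ∂μ, W ω ∈ psdSet d := hWε.mono fun _ hω => aboveSet_subset_psdSet hε.le hω
  have hTint : Integrable T μ := integrable_condExp.congr hT.symm
  have hVint : Integrable V μ := integrable_condExp.congr hV.symm
  have hTε : ∀ᵐ ω ∂μ, T ω ∈ aboveSet d ε := by
    filter_upwards [hT, (convex_aboveSet ε).condExp_mem hG hW (isClosed_aboveSet ε) hWε] with ω h1 h2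
    rwa [h1]
  have hVε : ∀ᵐ ω ∂μ, V ω ∈ aboveSet d ε := by
    filter_upwards [hV, (convex_aboveSet ε).condExp_mem hK hW (isClosed_aboveSet ε) hWε] with ω h1 h2
    rwa [h1]
  have hfV : Integrable (fun ω => trFun φ (V ω)) μ :=
    (h.integrable_trFun_condExp hK hW hWpsd hf).congr (by
      filter_upwards [hV] with ω hω using by rw [hω])
  obtain ⟨hb1, hb1'⟩ := h.integral_bregman_condExp hG hε hW hWε hf
  obtain ⟨hb2, hb2'⟩ := h.integral_bregman_condExp hG hε hVint hVε hfV
  have eT : (fun ω => bregman φ (W ω) ((μ[W | G]) ω)) =ᵐ[μ] fun ω => bregman φ (W ω) (T ω) := by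
    filter_upwards [hT] with ω hω using by rw [hω]
  have eU : (fun ω => bregman φ (V ω) ((μ[V | G]) ω)) =ᵐ[μ] fun ω => bregman φ (V ω) (U ω) := by
    filter_upwards [hUV] with ω hω using by rw [hω]
  have eT' : ∫ ω, trFun φ ((μ[W | G]) ω) ∂μ = ∫ ω, trFun φ (T ω) ∂μ :=
    integral_congr_ae (by filter_upwards [hT] with ω hω using by rw [hω])
  have eU' : ∫ ω, trFun φ ((μ[V | G]) ω) ∂μ = ∫ ω, trFun φ (U ω) ∂μ :=
    integral_congr_ae (by filter_upwards [hUV] with ω hω using by rw [hω])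
  rw [integral_congr_ae eT, eT'] at hb1'
  rw [integral_congr_ae eU, eU'] at hb2'
  -- Jensen for the pair (W, T), whose conditional expectation given `K` is (V, U); commutation
  -- makes `U` also the conditional expectation of `V` given `G`.
  have hjensen := (h.bregman_convexOn ε hε).map_condExp_le (μ := μ) (f := fun ω => (W ω, T ω)) hK
    (h.continuousOn_bregman hε).lowerSemicontinuousOn
    (by filter_upwards [hWε, hTε] with ω h1 h2 using ⟨h1, h2⟩)
    ((isClosed_aboveSet ε).prod (isClosed_aboveSet ε)) (hW.prodMk hTint) (hb1.congr eT)
  have hfst := ContinuousLinearMap.comp_condExp_comm (m := K) (hW.prodMk hTint)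
    (ContinuousLinearMap.fst ℝ (CMat d) (CMat d))
  have hsnd := ContinuousLinearMap.comp_condExp_comm (m := K) (hW.prodMk hTint)
    (ContinuousLinearMap.snd ℝ (CMat d) (CMat d))
  have hle : ∫ ω, bregman φ (V ω) (U ω) ∂μ ≤ ∫ ω, bregman φ (W ω) (T ω) ∂μ := by
    rw [← integral_condExp hK (f := fun ω => bregman φ (W ω) (T ω))]
    refine integral_mono_ae (hb2.congr eU) integrable_condExp ?_
    filter_upwards [hjensen, hfst, hsnd, hV, hUT] with ω h1 h2 h3 h4 h5
    have h6 : ((μ[fun ω => (W ω, T ω) | K]) ω).1 = V ω := by rw [h4]; exact h2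
    have h7 : ((μ[fun ω => (W ω, T ω) | K]) ω).2 = U ω := by rw [h5]; exact h3
    rw [← h6, ← h7]
    exact h1
  rw [hb1', hb2'] at hle
  linarith

/-! ### Removing the lower bound on the matrices. -/

/-- Contraction of a matrix towards the identity. -/
def shrink (ε : ℝ) (A : CMat d) : CMat d := (1 - ε) • A + ε • 1

lemma shrink_mem_aboveSet {ε : ℝ} (hε : ε ≤ 1) {A : CMat d} (hA : A ∈ psdSet d) :
    shrink ε A ∈ aboveSet d ε := by
  show (shrink ε A - ε • 1).PosSemidef
  rw [shrink, add_sub_cancel_right]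
  exact Matrix.PosSemidef.smul hA (by linarith)

lemma integrable_shrink (ε : ℝ) {Y : Ω → CMat d} (hY : Integrable Y μ) :
    Integrable (fun ω => shrink ε (Y ω)) μ :=
  (hY.smul (1 - ε)).add (integrable_const _)

lemma shrink_condExp (hm : m ≤ m₀) (ε : ℝ) {Y S : Ω → CMat d} (hY : Integrable Y μ)
    (hS : S =ᵐ[μ] μ[Y | m]) :
    (fun ω => shrink ε (S ω)) =ᵐ[μ] μ[fun ω => shrink ε (Y ω) | m] := by
  have h1 := condExp_add (hY.smul (1 - ε)) (integrable_const (ε • (1 : CMat d))) m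
  have h2 := condExp_smul (μ := μ) (1 - ε) Y m
  rw [condExp_const hm] at h1
  filter_upwards [h1, h2, hS] with ω h1 h2 h3
  have h4 : (μ[fun ω => shrink ε (Y ω) | m]) ω = (μ[(1 - ε) • Y | m]) ω + ε • 1 := h1
  rw [h4, h2, h3, shrink]
  rfl

lemma BregmanConvex.trFun_shrink_le (h : BregmanConvex d φ) {ε : ℝ} (h0 : 0 ≤ ε) (h1 : ε ≤ 1)
    {A : CMat d} (hA : A ∈ psdSet d) :
    trFun φ (shrink ε A) ≤ (1 - ε) * trFun φ A + ε * trFun φ (1 : CMat d) :=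
  h.convexOn_trFun.2 hA Matrix.PosSemidef.one (sub_nonneg.2 h1) h0 (by ring)

lemma continuous_shrink (A : CMat d) : Continuous fun ε : ℝ => shrink ε A := by
  unfold shrink; fun_prop

lemma BregmanConvex.aestronglyMeasurable_trFun_shrink (h : BregmanConvex d φ) {ε : ℝ}
    (h0 : 0 ≤ ε) (h1 : ε ≤ 1) {Y : Ω → CMat d} (hY : Integrable Y μ)
    (hpsd : ∀ᵐ ω ∂μ, Y ω ∈ psdSet d) :
    AEStronglyMeasurable (fun ω => trFun φ (shrink ε (Y ω))) μ :=
  aestronglyMeasurable_comp_of_continuousOn isClosed_psdSet h.continuousOn_trFun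
    (integrable_shrink ε hY).aestronglyMeasurable
    (hpsd.mono fun _ hω => aboveSet_subset_psdSet h0 (shrink_mem_aboveSet h1 hω))

/-- Convexity bounds the trace function on the segment to the identity from above, the affine
minorant from below, both uniformly in ε: a dominating function for the limit ε → 0. -/
lemma BregmanConvex.exists_bound_trFun_shrink (h : BregmanConvex d φ) {Y : Ω → CMat d}
    (hY : Integrable Y μ) (hpsd : ∀ᵐ ω ∂μ, Y ω ∈ psdSet d)
    (hf : Integrable (fun ω => trFun φ (Y ω)) μ) :
    ∃ b : Ω → ℝ, Integrable b μ ∧ ∀ ε, 0 ≤ ε → ε ≤ 1 →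
      ∀ᵐ ω ∂μ, ‖trFun φ (shrink ε (Y ω))‖ ≤ b ω := by
  obtain ⟨c, l, hcl⟩ := h.exists_affine_le
  refine ⟨fun ω => |c| + (|l (Y ω)| + |l 1|) + (|trFun φ (Y ω)| + |trFun φ (1 : CMat d)|), ?_, ?_⟩
  · exact ((integrable_const _).add ((l.integrable_comp hY).abs.add (integrable_const _))).add
      (hf.abs.add (integrable_const _))
  · intro ε h0 h1
    filter_upwards [hpsd] with ω hω
    have e1 := h.trFun_shrink_le h0 h1 hω
    have e2 := hcl _ (aboveSet_subset_psdSet h0 (shrink_mem_aboveSet h1 hω))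
    have e3 : l (shrink ε (Y ω)) = (1 - ε) * l (Y ω) + ε * l 1 := by simp [shrink]
    have key : ∀ x y : ℝ, |(1 - ε) * x + ε * y| ≤ |x| + |y| := by
      intro x y
      refine (abs_add_le _ _).trans ?_
      rw [abs_mul, abs_mul, abs_of_nonneg (sub_nonneg.2 h1), abs_of_nonneg h0]
      nlinarith [abs_nonneg x, abs_nonneg y]
    have k1 := abs_le.1 (key (l (Y ω)) (l 1))
    have k2 := abs_le.1 (key (trFun φ (Y ω)) (trFun φ (1 : CMat d)))
    have k3 := neg_abs_le c
    have p1 := abs_nonneg (l (Y ω))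
    have p2 := abs_nonneg (l 1)
    have p3 := abs_nonneg (trFun φ (Y ω))
    have p4 := abs_nonneg (trFun φ (1 : CMat d))
    have p5 := abs_nonneg c
    rw [e3] at e2
    rw [Real.norm_eq_abs, abs_le]
    constructor <;> linarith [k1.1, k2.2]

lemma BregmanConvex.tendsto_integral_trFun_shrink (h : BregmanConvex d φ) {Y : Ω → CMat d}
    (hY : Integrable Y μ) (hpsd : ∀ᵐ ω ∂μ, Y ω ∈ psdSet d)
    (hf : Integrable (fun ω => trFun φ (Y ω)) μ) :
    Filter.Tendsto (fun ε => ∫ ω, trFun φ (shrink ε (Y ω)) ∂μ) (nhdsWithin 0 (Set.Ioi 0))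
      (nhds (∫ ω, trFun φ (Y ω) ∂μ)) := by
  obtain ⟨b, hb, hbound⟩ := h.exists_bound_trFun_shrink hY hpsd hf
  have hmem : ∀ᶠ ε : ℝ in nhdsWithin 0 (Set.Ioi 0), ε ∈ Set.Ioo (0 : ℝ) 1 :=
    Ioo_mem_nhdsGT one_pos
  refine tendsto_integral_filter_of_dominated_convergence b ?_ ?_ hb ?_
  · filter_upwards [hmem] with ε hε using
      h.aestronglyMeasurable_trFun_shrink hε.1.le hε.2.le hY hpsd
  · filter_upwards [hmem] with ε hε using hbound ε hε.1.le hε.2.le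
  · filter_upwards [hpsd] with ω hω
    have h1 : Filter.Tendsto (fun ε => shrink ε (Y ω)) (nhdsWithin 0 (Set.Ioi 0))
        (nhdsWithin (Y ω) (psdSet d)) := by
      refine tendsto_nhdsWithin_iff.2 ⟨?_, ?_⟩
      · have := ((continuous_shrink (Y ω)).tendsto 0).mono_left
          (nhdsWithin_le_nhds (s := Set.Ioi 0))
        simpa [shrink] using this
      · filter_upwards [hmem] with ε hε using
          aboveSet_subset_psdSet hε.1.le (shrink_mem_aboveSet hε.2.le hω)
    exact (h.continuousOn_trFun (Y ω) hω).tendsto.comp h1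

/-- Four-term inequality for commuting conditional expectations. -/
lemma BregmanConvex.four_term (h : BregmanConvex d φ) {G K : MeasurableSpace Ω}
    (hG : G ≤ m₀) (hK : K ≤ m₀) {W T V U : Ω → CMat d}
    (hW : Integrable W μ) (hpsd : ∀ᵐ ω ∂μ, W ω ∈ psdSet d)
    (hf : Integrable (fun ω => trFun φ (W ω)) μ)
    (hT : T =ᵐ[μ] μ[W | G]) (hV : V =ᵐ[μ] μ[W | K]) (hUT : U =ᵐ[μ] μ[T | K])
    (hUV : U =ᵐ[μ] μ[V | G]) :
    ∫ ω, trFun φ (T ω) ∂μ + ∫ ω, trFun φ (V ω) ∂μ ≤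
      ∫ ω, trFun φ (W ω) ∂μ + ∫ ω, trFun φ (U ω) ∂μ := by
  have inherit : ∀ {m : MeasurableSpace Ω} {Y S : Ω → CMat d}, m ≤ m₀ → Integrable Y μ →
      (∀ᵐ ω ∂μ, Y ω ∈ psdSet d) → Integrable (fun ω => trFun φ (Y ω)) μ → S =ᵐ[μ] μ[Y | m] →
      Integrable S μ ∧ (∀ᵐ ω ∂μ, S ω ∈ psdSet d) ∧ Integrable (fun ω => trFun φ (S ω)) μ := by
    intro m Y S hm hY hp hfY hS
    refine ⟨integrable_condExp.congr hS.symm, ?_,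
      (h.integrable_trFun_condExp hm hY hp hfY).congr ?_⟩
    · filter_upwards [hS, convex_psdSet.condExp_mem hm hY isClosed_psdSet hp] with ω h1 h2
      rwa [h1]
    · filter_upwards [hS] with ω hω using by rw [hω]
  obtain ⟨iT, pT, fT⟩ := inherit hG hW hpsd hf hT
  obtain ⟨iV, pV, fV⟩ := inherit hK hW hpsd hf hV
  obtain ⟨iU, pU, fU⟩ := inherit hK iT pT fT hUT
  -- Shrinking is affine and fixes the identity, so it commutes with all the conditional
  -- expectations; the inequality holds for each ε and passes to the limit.
  refine le_of_tendsto_of_tendsto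
    ((h.tendsto_integral_trFun_shrink iT pT fT).add (h.tendsto_integral_trFun_shrink iV pV fV))
    ((h.tendsto_integral_trFun_shrink hW hpsd hf).add (h.tendsto_integral_trFun_shrink iU pU fU)) ?_
  filter_upwards [Ioo_mem_nhdsGT (one_pos (α := ℝ))] with ε hε
  obtain ⟨b, hb, hbound⟩ := h.exists_bound_trFun_shrink hW hpsd hf
  exact h.four_term_of_aboveSet hG hK hε.1 (integrable_shrink ε hW)
    (hpsd.mono fun _ hω => shrink_mem_aboveSet hε.2.le hω)
    (hb.mono' (h.aestronglyMeasurable_trFun_shrink hε.1.le hε.2.le hW hpsd)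
      (hbound ε hε.1.le hε.2.le))
    (shrink_condExp hG ε hW hT) (shrink_condExp hK ε hW hV) (shrink_condExp hK ε iT hUT)
    (shrink_condExp hG ε iV hUV)

end Conditional

/-! ### Conditional expectations over independent σ-algebras. -/

section CondExpIndep

variable {Ω E : Type*} {m₁ m₂ K m₀ : MeasurableSpace Ω} {μ : Measure[m₀] Ω}
  [IsProbabilityMeasure μ] [NormedAddCommGroup E] [NormedSpace ℝ E] [CompleteSpace E]

lemma generateFrom_inter_eq_sup :
    m₁ ⊔ m₂ = MeasurableSpace.generateFrom
      {s | ∃ A B, MeasurableSet[m₁] A ∧ MeasurableSet[m₂] B ∧ A ∩ B = s} := by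
  refine le_antisymm (sup_le (fun A hA => ?_) (fun B hB => ?_))
    (MeasurableSpace.generateFrom_le ?_)
  · exact MeasurableSpace.measurableSet_generateFrom ⟨A, Set.univ, hA, .univ, Set.inter_univ A⟩
  · exact MeasurableSpace.measurableSet_generateFrom ⟨Set.univ, B, .univ, hB, Set.univ_inter B⟩
  · rintro _ ⟨A, B, hA, hB, rfl⟩
    exact MeasurableSet.inter (le_sup_left (a := m₁) (b := m₂) A hA)
      (le_sup_right (a := m₁) (b := m₂) B hB)

lemma isPiSystem_inter :
    IsPiSystem {s | ∃ A B, MeasurableSet[m₁] A ∧ MeasurableSet[m₂] B ∧ A ∩ B = s} := by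
  rintro _ ⟨A, B, hA, hB, rfl⟩ _ ⟨A', B', hA', hB', rfl⟩ _
  exact ⟨A ∩ A', B ∩ B', hA.inter hA', hB.inter hB', Set.inter_inter_inter_comm _ _ _ _⟩

/-- The integral over the intersection of a set with an independent one. -/
lemma setIntegral_inter_of_indep (hK : K ≤ m₀) (hm₂ : m₂ ≤ m₀) (hind : Indep K m₂ μ) {f : Ω → E}
    (hf : Integrable f μ) (hfK : StronglyMeasurable[K] f) {A B : Set Ω} (hA : MeasurableSet[K] A)
    (hB : MeasurableSet[m₂] B) : ∫ ω in A ∩ B, f ω ∂μ = μ.real B • ∫ ω in A, f ω ∂μ := by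
  -- Given the independent `m₂`, the conditional expectation of `f` restricted to `A` is constant.
  have h1 := condExp_indep_eq hK hm₂ (hfK.indicator hA) hind
  have h2 := setIntegral_condExp hm₂ (hf.indicator (hK _ hA)) hB
  rw [setIntegral_congr_ae (g := fun _ => ∫ ω, A.indicator f ω ∂μ) (hm₂ _ hB)
    (by filter_upwards [h1] with ω hω _ using hω), setIntegral_const,
    integral_indicator (hK _ hA), setIntegral_indicator (hK _ hA), Set.inter_comm] at h2
  exact h2.symm

/-- Conditioning on an independent σ-algebra in addition has no effect. -/
lemma condExp_sup_of_indep (hm₁K : m₁ ≤ K) (hK : K ≤ m₀) (hm₂ : m₂ ≤ m₀) (hind : Indep K m₂ μ)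
    {f : Ω → E} (hf : Integrable f μ) (hfK : StronglyMeasurable[K] f) :
    μ[f | m₁ ⊔ m₂] =ᵐ[μ] μ[f | m₁] := by
  have hm₁ : m₁ ≤ m₀ := hm₁K.trans hK
  have hsup : m₁ ⊔ m₂ ≤ m₀ := sup_le hm₁ hm₂
  symm
  refine ae_eq_condExp_of_forall_setIntegral_eq hsup hf
    (fun _ _ _ => integrable_condExp.integrableOn) (fun s hs _ => ?_)
    ⟨μ[f | m₁], stronglyMeasurable_condExp.mono le_sup_left, Filter.EventuallyEq.rfl⟩
  have hgint : Integrable (μ[f | m₁]) μ := integrable_condExp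
  -- On a generator A ∩ B independence factors out the probability of `B`, which leaves the defining
  -- property of conditioning on `m₁`.
  induction s, hs using MeasurableSpace.induction_on_inter generateFrom_inter_eq_sup
    isPiSystem_inter with
  | empty => simp
  | basic t ht =>
    obtain ⟨A, B, hA, hB, rfl⟩ := ht
    rw [setIntegral_inter_of_indep hK hm₂ hind hf hfK (hm₁K _ hA) hB,
      setIntegral_inter_of_indep hK hm₂ hind hgint (stronglyMeasurable_condExp.mono hm₁K)
        (hm₁K _ hA) hB, setIntegral_condExp hm₁ hf hA]
  | compl t ht ih =>
    have h1 := integral_add_compl (hsup _ ht) hgint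
    have h2 := integral_add_compl (hsup _ ht) hf
    rw [ih (measure_lt_top _ _), integral_condExp hm₁, ← h2] at h1
    exact add_left_cancel h1
  | iUnion g hg hgm ih =>
    rw [integral_iUnion (fun i => hsup _ (hgm i)) hg hgint.integrableOn,
      integral_iUnion (fun i => hsup _ (hgm i)) hg hf.integrableOn]
    exact tsum_congr fun i => ih i (measure_lt_top _ _)

variable {ι : Type*} {m : ι → MeasurableSpace Ω}

/-- The σ-algebra generated by the σ-algebras with index in `S`. -/
abbrev sigmaOn (m : ι → MeasurableSpace Ω) (S : Set ι) : MeasurableSpace Ω := ⨆ j ∈ S, m j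

lemma sigmaOn_mono {S T : Set ι} (h : S ⊆ T) : sigmaOn m S ≤ sigmaOn m T :=
  biSup_mono h

lemma sigmaOn_union (S T : Set ι) : sigmaOn m (S ∪ T) = sigmaOn m S ⊔ sigmaOn m T :=
  iSup_union

lemma sigmaOn_le (hm : ∀ i, m i ≤ m₀) (S : Set ι) : sigmaOn m S ≤ m₀ :=
  iSup₂_le fun i _ => hm i

/-- Conditional expectations over independent σ-algebras commute. -/
lemma condExp_condExp_sigmaOn (hm : ∀ i, m i ≤ m₀) (hind : iIndep m μ) {f : Ω → E}
    (S T : Set ι) :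
    μ[μ[f | sigmaOn m T] | sigmaOn m S] =ᵐ[μ] μ[f | sigmaOn m (S ∩ T)] := by
  -- The indices in S \ T are independent of everything over `T`, so they can be dropped from the
  -- outer conditioning; the tower property does the rest.
  have h1 : sigmaOn m S = sigmaOn m (S ∩ T) ⊔ sigmaOn m (S \ T) := by
    rw [← sigmaOn_union, Set.inter_union_sdiff]
  have hindep : Indep (sigmaOn m T) (sigmaOn m (S \ T)) μ :=
    indep_iSup_of_disjoint hm hind Set.disjoint_sdiff_right
  have hle : sigmaOn m (S ∩ T) ≤ sigmaOn m T := sigmaOn_mono Set.inter_subset_right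
  rw [h1]
  exact (condExp_sup_of_indep hle (sigmaOn_le hm T) (sigmaOn_le hm _) hindep integrable_condExp
    stronglyMeasurable_condExp).trans (condExp_condExp_of_le hle (sigmaOn_le hm T))

end CondExpIndep

/-! ### Telescoping over the variables. -/

section Subadditivity

variable {Ω : Type*} {n d : ℕ}

lemma sigmaOmit_eq_sigmaOn {E : Fin n → Type*} [∀ i, MeasurableSpace (E i)] (X : ∀ i, Ω → E i)
    (i : Fin n) :
    sigmaOmit X i =
      sigmaOn (fun j => MeasurableSpace.comap (X j) inferInstance) {j | j ≠ i} := by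
  rw [sigmaOmit, MeasurableSpace.pi, MeasurableSpace.comap_iSup, sigmaOn, iSup_subtype']
  simp only [MeasurableSpace.comap_comp]
  rfl

lemma stronglyMeasurable_of_entries {m : MeasurableSpace Ω} {Z : Ω → CMat d}
    (h : ∀ j k, Measurable[m] fun ω => Z ω j k) : StronglyMeasurable[m] Z := by
  have h1 : Measurable[m] (fun ω j k => Z ω j k) :=
    measurable_pi_iff.2 fun j => measurable_pi_iff.2 fun k => h j k
  have h2 : Continuous (fun M : Fin d → Fin d → ℂ => (Matrix.of M : CMat d)) := continuous_id
  exact h2.comp_stronglyMeasurable h1.stronglyMeasurable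

variable [MeasurableSpace Ω] {μ : Measure Ω} [IsProbabilityMeasure μ]

/-- Subadditivity of the matrix entropy over independent σ-algebras. -/
lemma BregmanConvex.trFun_subadditive {φ : ℝ → ℝ} (h : BregmanConvex d φ)
    {m : Fin n → MeasurableSpace Ω} (hm : ∀ i, m i ≤ ‹MeasurableSpace Ω›) (hind : iIndep m μ)
    {Z : Ω → CMat d} (hZ : Integrable Z μ) (hpsd : ∀ᵐ ω ∂μ, Z ω ∈ psdSet d)
    (hf : Integrable (fun ω => trFun φ (Z ω)) μ)
    (hZm : StronglyMeasurable[sigmaOn m Set.univ] Z) :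
    ∫ ω, trFun φ (Z ω) ∂μ - trFun φ (∫ ω, Z ω ∂μ) ≤
      ∑ i, (∫ ω, trFun φ (Z ω) ∂μ - ∫ ω, trFun φ ((μ[Z | sigmaOn m {j | j ≠ i}]) ω) ∂μ) := by
  set S : ℕ → Set (Fin n) := fun k => {j | (j : ℕ) < k} with hS
  set a : ℕ → ℝ := fun k => ∫ ω, trFun φ ((μ[Z | sigmaOn m (S k)]) ω) ∂μ with ha
  have hstep : ∀ i : Fin n, a (i + 1) - a i ≤
      ∫ ω, trFun φ (Z ω) ∂μ - ∫ ω, trFun φ ((μ[Z | sigmaOn m {j | j ≠ i}]) ω) ∂μ := by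
    intro i
    -- With indices from 0, S (i + 1) consists of the indices up to and including `i`; omitting `i`
    -- leaves S i.
    have e : S (i + 1) ∩ {j | j ≠ i} = S i := by
      ext j
      simp only [hS, Set.mem_inter_iff, Set.mem_ofPred_eq, ne_eq, Fin.ext_iff]
      omega
    have e' : {j | j ≠ i} ∩ S (i + 1) = S i := by rw [Set.inter_comm, e]
    have h1 := condExp_condExp_sigmaOn (f := Z) hm hind (S (i + 1)) {j | j ≠ i}
    have h2 := condExp_condExp_sigmaOn (f := Z) hm hind {j | j ≠ i} (S (i + 1))
    rw [e] at h1
    rw [e'] at h2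
    have := h.four_term (sigmaOn_le hm (S (i + 1))) (sigmaOn_le hm {j | j ≠ i}) hZ hpsd hf
      Filter.EventuallyEq.rfl Filter.EventuallyEq.rfl h2.symm h1.symm
    simp only [ha]
    linarith
  have hSn : S n = Set.univ := by ext j; simp [hS]
  have hS0 : S 0 = ∅ := by ext j; simp [hS]
  have han : a n = ∫ ω, trFun φ (Z ω) ∂μ := by
    simp only [ha]
    rw [hSn, condExp_of_stronglyMeasurable (sigmaOn_le hm _) hZm hZ]
  have ha0 : a 0 = trFun φ (∫ ω, Z ω ∂μ) := by
    have hbot : sigmaOn m (∅ : Set (Fin n)) = ⊥ := by simp [sigmaOn]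
    simp only [ha]
    rw [hS0, hbot, condExp_bot]
    simp
  calc _ = a n - a 0 := by rw [han, ha0]
    _ = ∑ k ∈ Finset.range n, (a (k + 1) - a k) := (Finset.sum_range_sub a n).symm
    _ = ∑ i : Fin n, (a (i + 1) - a i) := (Fin.sum_univ_eq_sum_range _ n).symm
    _ ≤ _ := Finset.sum_le_sum fun i _ => hstep i

end Subadditivity

end MatrixEntropy

end

open MatrixEntropy
theorem theorem1p2
    {Ω : Type*} [MeasurableSpace Ω] (μ : Measure Ω) [IsProbabilityMeasure μ]
    (n d : ℕ) (E : Fin n → Type*)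
    [∀ i, TopologicalSpace (E i)] [∀ i, PolishSpace (E i)]
    [∀ i, MeasurableSpace (E i)] [∀ i, BorelSpace (E i)]
    (X : ∀ i, Ω → E i) (hX : ∀ i, Measurable (X i)) (hindep : iIndepFun X μ)
    (F : (∀ i, E i) → CMat d) (hF : ∀ j k, Measurable (fun x => F x j k))
    (Z : Ω → CMat d) (hZ : ∀ ω, Z ω = F (fun i => X i ω)) (hpsd : ∀ ω, (Z ω).PosSemidef)
    (φ : ℝ → ℝ) (hφ : φ ∈ PhiInf)
    (hZint : Integrable (fun ω => ‖Z ω‖) μ)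
    (hφint : Integrable (fun ω => ‖cfc φ (Z ω)‖) μ) :
    (∀ i, Integrable (condEntropy φ Z μ (sigmaOmit X i)) μ) ∧
      entropy φ Z μ ≤ ∑ i, ∫ ω, condEntropy φ Z μ (sigmaOmit X i) ω ∂μ := by
  have h : BregmanConvex d φ := bregmanConvex_of_mem_phiInf hφ
  set m : Fin n → MeasurableSpace Ω := fun j => MeasurableSpace.comap (X j) inferInstance with hmdef
  have hm : ∀ i, m i ≤ ‹MeasurableSpace Ω› := fun i => (hX i).comap_le
  have hZm : StronglyMeasurable[sigmaOn m Set.univ] Z := by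
    refine stronglyMeasurable_of_entries fun j k => ?_
    simp only [hZ]
    refine (hF j k).comp ((@measurable_pi_iff Ω (Fin n) E (sigmaOn m Set.univ) _ _).2 fun i => ?_)
    exact (comap_measurable (X i)).mono (le_iSup₂_of_le i (Set.mem_univ i) le_rfl) le_rfl
  have hZsm : StronglyMeasurable Z := hZm.mono (sigmaOn_le hm _)
  have hZi : Integrable Z μ := (integrable_norm_iff hZsm.aestronglyMeasurable).1 hZint
  have hpsd' : ∀ᵐ ω ∂μ, Z ω ∈ psdSet d := Filter.Eventually.of_forall hpsd
  have hf : Integrable (fun ω => trFun φ (Z ω)) μ := by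
    refine Integrable.mono' (hφint.const_mul ‖reTr (d := d)‖)
      (aestronglyMeasurable_comp_of_continuousOn isClosed_psdSet h.continuousOn_trFun
        hZsm.aestronglyMeasurable hpsd') (Filter.Eventually.of_forall fun ω => ?_)
    exact reTr.le_opNorm _
  have hle : ∀ i, sigmaOmit X i ≤ ‹MeasurableSpace Ω› := fun i => by
    rw [sigmaOmit_eq_sigmaOn]
    exact sigmaOn_le hm _
  have hfc : ∀ i, Integrable (fun ω => trFun φ ((μ[Z | sigmaOmit X i]) ω)) μ := fun i =>
    h.integrable_trFun_condExp (hle i) hZi hpsd' hf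
  -- Integrating removes the conditioning on the first term only, which leaves the summand of the
  -- σ-algebra version.
  have hint : ∀ i, ∫ ω, condEntropy φ Z μ (sigmaOmit X i) ω ∂μ =
      ∫ ω, trFun φ (Z ω) ∂μ - ∫ ω, trFun φ ((μ[Z | sigmaOmit X i]) ω) ∂μ := fun i =>
    (integral_sub integrable_condExp (hfc i)).trans (by rw [integral_condExp (hle i)]; rfl)
  refine ⟨fun i => integrable_condExp.sub (hfc i), ?_⟩
  have := h.trFun_subadditive hm hindep hZi hpsd' hf hZm
  rw [Finset.sum_congr rfl fun i _ => hint i]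
  simp only [sigmaOmit_eq_sigmaOn]
  exact this
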